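/- Theorem 5.4. Let $m\ge 1$ and let $\Gamma\subset\mathbb R^m\times\mathbb R$ be a lattice such that the coordinate projections $p_1:\Gamma\to\mathbb R^m$ and $p_2:\Gamma\to\mathbb R$ are both injective and have dense image. Let $\Gamma^*=\{\eta\in\mathbb R^m\times\mathbb R : \gamma\cdot\eta\in\mathbb Z \text{ for all }\gamma\in\Gamma\}$ be the dual lattice, with coordinate projections $p_1^*:\Gamma^*\to\mathbb R^m$ and $p_2^*:\Gamma^*\to\mathbb R$. Let $\Omega\subset\mathbb R$ be a nondegenerate compact interval, symmetric around the origin, whose boundary does not meet $p_2(\Gamma)$, and let $\Lambda(\Omega)=\{p_1(\gamma):\gamma\in\Gamma,\ p_2(\gamma)\in\Omega\}$ be the corresponding (simple, generic) model set. Fix $0<\epsilon<1$, write $|\cdot|$ for the length of a subset of $\mathbb R$, $\operatorname{sinc}(t)=\frac{\sin \pi t}{\pi t}$ (with $\operatorname{sinc}(0)=1$) and $\Omega_n=(1-\epsilon^n)\Omega$, and put $$\Psi(t)=\lim_{n\to\infty}\prod_{s=0}^\infty \operatorname{sinc}\bigl(t\,|\epsilon^{ns}\Omega_n|\bigr)\quad\text{(a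 uniform limit)},\qquad \Phi=|\Omega|\,(\Psi*\Psi).$$ For $x,\omega\in\mathbb R^m$ let $T_xf(t)=f(t-x)$ and $M_\omega f(t)=e^{2\pi i\omega\cdot t}f(t)$, and let $\langle f,g\rangle=\int f\overline g$ on $L^2(\mathbb R^m)$. Let $W(L^2,\ell^1)$ be the space of measurable $f$ with $\sum_{k\in\mathbb Z^m}\|f\,\mathbf 1_{k+[0,1]^m}\|_2<\infty$. Let $A\in GL_m(\mathbb R)$ and $g_1,\dots,g_L,h_1,\dots,h_L\in W(L^2,\ell^1)$, and consider the Gabor system $$\mathcal G(g,\Lambda(\Omega),A\mathbb Z^m)=\{T_\lambda M_{An}g_l : 1\le l\le L,\ \lambda\in\Lambda(\Omega),\ n\in\mathbb Z^m\}$$ and, likewise, $\mathcal G(h,\Lambda(\Omega),A\mathbb Z^m)$. Assume that both are Bessel sequences for $L^2(\mathbb R^m)$, that is, for each of them there is $B>0$ such that the sum of $|\langle f,e\rangle|^2$ over the members $e$ of the system is at most $B\|f\|_2^2$ for all $f\in L^2(\mathbb R^m)$. Then the density $$D(\Lambda(\Omega))=\lim_{R\to\infty}\frac{\#\bigl(\Lambda(\Omega)\cap(x+R[0,1]^m)\bigr)}{R^m}$$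 exists and does not depend on $x\in\mathbb R^m$, and $\mathcal G(h,\Lambda(\Omega),A\mathbb Z^m)$ is a dual system to $\mathcal G(g,\Lambda(\Omega),A\mathbb Z^m)$, that is, $$f=\sum_{l=1}^L\sum_{\lambda\in\Lambda(\Omega)}\sum_{n\in\mathbb Z^m}\langle f,T_\lambda M_{An}g_l\rangle\,T_\lambda M_{An}h_l\quad\text{for all } f\in L^2(\mathbb R^m)$$ (with unconditional convergence in $L^2(\mathbb R^m)$), if and only if $$D(\Lambda(\Omega))\,|\det A|^{-1}\,\Phi(-p_2^*(\eta))\sum_{l=1}^L\bigl\langle T_{A^{-T}v}M_{p_1^*(\eta)}h_l,\,g_l\bigr\rangle=\delta_{\eta,0}\,\delta_{v,0}$$ for all $\eta\in\Gamma^*$ and $v\in\mathbb Z^m$, where $A^{-T}=(A^T)^{-1}$. -/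

import Mathlib

open MeasureTheory Filter Topology
open scoped ENNReal Pointwise

namespace ModelSetGabor

noncomputable section

/-- The Euclidean space `ℝ^m`. -/
abbrev Eucl (m : ℕ) : Type := EuclideanSpace ℝ (Fin m)

/-- The Hilbert space `L²(ℝ^m)` of complex-valued functions. -/
abbrev L2 (m : ℕ) : Type := Lp ℂ 2 (volume : Measure (Eucl m))

/-! ### Time-frequency shifts -/

/-- Translation `(T_x f)(t) = f (t - x)` on `L²(ℝ^m)`. -/
def translation {m : ℕ} (x : Eucl m) (f : L2 m) : L2 m :=
  Lp.compMeasurePreserving (fun t : Eucl m => t - x) (measurePreserving_sub_right volume x) f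

/-- The character `t ↦ exp(2πi b·t)`. -/
def character {m : ℕ} (b t : Eucl m) : ℂ :=
  Complex.exp (2 * Real.pi * Complex.I * ((inner ℝ b t : ℝ) : ℂ))

lemma norm_character {m : ℕ} (b t : Eucl m) : ‖character b t‖ = 1 := by
  have h : 2 * Real.pi * Complex.I * ((inner ℝ b t : ℝ) : ℂ)
      = ((2 * Real.pi * inner ℝ b t : ℝ) : ℂ) * Complex.I := by
    push_cast; ring
  rw [character, h, Complex.norm_exp_ofReal_mul_I]

lemma continuous_character {m : ℕ} (b : Eucl m) : Continuous (character b) := by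
  unfold character
  fun_prop

lemma memLp_character_mul {m : ℕ} (b : Eucl m) (f : L2 m) :
    MemLp (fun t => character b t * f t) 2 (volume : Measure (Eucl m)) := by
  refine (Lp.memLp f).of_le
    ((continuous_character b).aestronglyMeasurable.mul (Lp.aestronglyMeasurable f)) ?_
  filter_upwards with t
  rw [norm_mul, norm_character, one_mul]

/-- Modulation `(M_b f)(t) = exp(2πi b·t) f(t)` on `L²(ℝ^m)`. -/
def modulation {m : ℕ} (b : Eucl m) (f : L2 m) : L2 m :=
  (memLp_character_mul b f).toLp (fun t => character b t * f t)

/-! ### The Wiener amalgam space -/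

/-- The cube `B(x, R) = x + R [0,1]^m`. -/
def cube {m : ℕ} (x : Eucl m) (R : ℝ) : Set (Eucl m) :=
  {t | ∀ i, x i ≤ t i ∧ t i ≤ x i + R}

/-- The norm `∑_{k ∈ ℤ^m} ‖f 1_{k + [0,1]^m}‖_p` of the Wiener amalgam space `W(L^p, ℓ¹)`,
with values in `[0, ∞]`. -/
def amalgamNorm {m : ℕ} (p : ℝ≥0∞) (f : Eucl m → ℂ) : ℝ≥0∞ :=
  ∑' k : Fin m → ℤ,
    eLpNorm f p (volume.restrict (cube (WithLp.toLp 2 fun i => (k i : ℝ)) 1))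

/-- `f ∈ W(L², ℓ¹)`. -/
def MemAmalgam {m : ℕ} (f : L2 m) : Prop :=
  amalgamNorm 2 (f : Eucl m → ℂ) < ∞

/-! ### Lattices and model sets -/

/-- The conditions on the position of a lattice `Γ ⊂ ℝ^m × ℝ`: both coordinate projections are
injective on `Γ` and have dense image. -/
structure IsCutAndProject {m : ℕ} (Γ : Submodule ℤ (Eucl m × ℝ)) : Prop where
  injOn_fst : Set.InjOn Prod.fst (Γ : Set (Eucl m × ℝ))
  injOn_snd : Set.InjOn Prod.snd (Γ : Set (Eucl m × ℝ))
  dense_fst : Dense (Prod.fst '' (Γ : Set (Eucl m × ℝ)))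
  dense_snd : Dense (Prod.snd '' (Γ : Set (Eucl m × ℝ)))

/-- The dual lattice `Γ* = {η : γ·η ∈ ℤ for all γ ∈ Γ}`. -/
def dualLattice {m : ℕ} (Γ : Submodule ℤ (Eucl m × ℝ)) : Submodule ℤ (Eucl m × ℝ) where
  carrier := {η | ∀ γ ∈ Γ, ∃ k : ℤ, inner ℝ γ.1 η.1 + γ.2 * η.2 = k}
  zero_mem' := fun γ _ => ⟨0, by simp⟩
  add_mem' := by
    intro a b ha hb γ hγ
    obtain ⟨k, hk⟩ := ha γ hγ
    obtain ⟨l, hl⟩ := hb γ hγ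
    refine ⟨k + l, ?_⟩
    rw [Prod.fst_add, Prod.snd_add, inner_add_right]
    push_cast
    linarith
  smul_mem' := by
    intro c a ha γ hγ
    obtain ⟨k, hk⟩ := ha γ hγ
    refine ⟨c * k, ?_⟩
    rw [Prod.smul_fst, Prod.smul_snd, ← Int.cast_smul_eq_zsmul ℝ c a.1,
      ← Int.cast_smul_eq_zsmul ℝ c a.2, real_inner_smul_right, smul_eq_mul]
    push_cast
    rw [← hk]
    ring

/-- A window in `ℝ` that is a (nondegenerate, compact) interval: compact, non-empty, equal to the
closure of its interior, with boundary of Lebesgue measure zero. -/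
structure IsIntervalWindow (Ω : Set ℝ) : Prop where
  nonempty : Ω.Nonempty
  isCompact : IsCompact Ω
  closure_interior : closure (interior Ω) = Ω
  null_frontier : volume (frontier Ω) = 0
  ordConnected : Ω.OrdConnected

/-- The model set `Λ(Ω) = {p₁(γ) : γ ∈ Γ, p₂(γ) ∈ Ω}`. -/
def modelSet {m : ℕ} (Γ : Submodule ℤ (Eucl m × ℝ)) (Ω : Set ℝ) : Set (Eucl m) :=
  {x | ∃ γ ∈ Γ, γ.2 ∈ Ω ∧ γ.1 = x}

/-- `Λ(Ω)` is generic: `p₂(Γ)` does not meet the boundary of `Ω`. -/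
def IsGeneric {m : ℕ} (Γ : Submodule ℤ (Eucl m × ℝ)) (Ω : Set ℝ) : Prop :=
  ∀ γ ∈ Γ, γ.2 ∉ frontier Ω

/-- `Λ` is locally finite and has density `d`, that is
`#(Λ ∩ B(x, R)) / R^m → d` as `R → ∞`, for every `x ∈ ℝ^m`. -/
def HasDensity {m : ℕ} (Λ : Set (Eucl m)) (d : ℝ) : Prop :=
  (∀ x R, (Λ ∩ cube x R).Finite) ∧
  ∀ x, Tendsto (fun R : ℝ => ((Λ ∩ cube x R).ncard : ℝ) / R ^ m) atTop (𝓝 d)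

/-! ### The function `Φ` -/

/-- `∏_{s ≥ 0} sinc(t |ε^{ns} Ω_n|)` with `Ω_n = (1 - ε^n) Ω`, where `|·|` is the length and
`sinc u = sin(πu)/(πu)` (Mathlib's `Real.sinc` has no factor `π`). -/
def psiHat (Ω : Set ℝ) (ε : ℝ) (n : ℕ) (t : ℝ) : ℝ :=
  ∏' s : ℕ, Real.sinc (Real.pi * (t * volume.real (ε ^ (n * s) • ((1 - ε ^ n) • Ω))))

/-- `Ψ = lim_n psiHat Ω ε n`; the limit exists, and is uniform, by `tendstoUniformly_psiHat`. -/
def Psi (Ω : Set ℝ) (ε : ℝ) (t : ℝ) : ℝ :=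
  limUnder atTop fun n => psiHat Ω ε n t

/-- `Φ = |Ω| (Ψ * Ψ)`, with the convolution on `ℝ`. -/
def Phi (Ω : Set ℝ) (ε : ℝ) (t : ℝ) : ℝ :=
  volume.real Ω * ∫ u, Psi Ω ε u * Psi Ω ε (t - u)

lemma abs_sinc_sub_one_le (x : ℝ) : |Real.sinc x - 1| ≤ |x| := by
  rcases eq_or_ne x 0 with rfl | hx
  · simp
  have hx' : 0 < |x| := abs_pos.mpr hx
  rcases le_or_gt 2 |x| with h2 | h2
  · have h := abs_le.mp (Real.abs_sinc_le_one x)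
    exact (abs_le.mpr ⟨by linarith, by linarith⟩)
  have key : ∀ y : ℝ, 0 < y → y < 2 → |Real.sinc y - 1| ≤ y := by
    intro y hy hy2
    have h1 := Real.sin_gt_sub_cube hy
    have h2 := Real.sin_lt hy
    rw [Real.sinc_of_ne_zero hy.ne', div_sub_one hy.ne', abs_div, abs_of_pos hy,
      div_le_iff₀ hy, abs_le]
    constructor <;> nlinarith [mul_pos hy hy]
  rcases abs_cases x with ⟨he, _⟩ | ⟨he, _⟩
  · rw [he]; exact key x (he ▸ hx') (he ▸ h2)
  · rw [he, ← Real.sinc_neg]; exact key (-x) (he ▸ hx') (he ▸ h2)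

lemma abs_prod_sub_one_le (f : ℕ → ℝ) (hf : ∀ s, |f s| ≤ 1) (S : Finset ℕ) :
    |∏ s ∈ S, f s - 1| ≤ ∑ s ∈ S, |f s - 1| := by
  classical
  induction S using Finset.induction_on with
  | empty => simp
  | insert a S ha ih =>
    rw [Finset.prod_insert ha, Finset.sum_insert ha]
    have h : f a * ∏ s ∈ S, f s - 1 = (f a - 1) + f a * (∏ s ∈ S, f s - 1) := by ring
    rw [h]
    refine (abs_add_le _ _).trans (add_le_add le_rfl ?_)
    rw [abs_mul]
    exact (mul_le_of_le_one_left (abs_nonneg _) (hf a)).trans ih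

lemma abs_sinc_mul_sub_sinc_le {a : ℝ} (ha : 0 < a) (ha1 : a ≤ 1) (x : ℝ) :
    |Real.sinc (x * a) - Real.sinc x| ≤ 2 * (1 - a) / a := by
  rcases eq_or_ne x 0 with rfl | hx
  · simp only [zero_mul, sub_self, abs_zero]
    exact div_nonneg (by linarith) ha.le
  have hx' : 0 < |x| := abs_pos.mpr hx
  rw [Real.sinc_of_ne_zero (mul_ne_zero hx ha.ne'), Real.sinc_of_ne_zero hx]
  have h : Real.sin (x * a) / (x * a) - Real.sin x / x
      = ((Real.sin (x * a) - Real.sin x) + (1 - a) * Real.sin x) / (x * a) := by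
    field_simp; ring
  have h1 : |Real.sin (x * a) - Real.sin x| ≤ (1 - a) * |x| := by
    have h2 := Real.abs_sin_sub_sin_le (x * a) x
    have h3 : x * a - x = -((1 - a) * x) := by ring
    rwa [h3, abs_neg, abs_mul, abs_of_nonneg (by linarith : 0 ≤ 1 - a)] at h2
  have h2 : |(1 - a) * Real.sin x| ≤ (1 - a) * |x| := by
    rw [abs_mul, abs_of_nonneg (by linarith : 0 ≤ 1 - a)]
    exact mul_le_mul_of_nonneg_left Real.abs_sin_le_abs (by linarith)
  rw [h, abs_div, abs_mul, abs_of_pos ha, div_le_div_iff₀ (by positivity) ha]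
  have h3 := abs_add_le (Real.sin (x * a) - Real.sin x) ((1 - a) * Real.sin x)
  nlinarith

lemma psiHat_eq (Ω : Set ℝ) {ε : ℝ} (h0 : 0 < ε) (h1 : ε < 1) (n : ℕ) (t : ℝ) :
    psiHat Ω ε n t =
      ∏' s : ℕ, Real.sinc (Real.pi * (t * volume.real Ω) * (1 - ε ^ n) * (ε ^ n) ^ s) := by
  unfold psiHat
  refine tprod_congr fun s => ?_
  have hn : 0 ≤ 1 - ε ^ n := by linarith [pow_le_one₀ h0.le h1.le (n := n)]
  rw [Measure.real, Measure.addHaar_smul, Measure.addHaar_smul, ENNReal.toReal_mul,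
    ENNReal.toReal_mul, ENNReal.toReal_ofReal (abs_nonneg _),
    ENNReal.toReal_ofReal (abs_nonneg _)]
  simp only [Module.finrank_self, pow_one]
  rw [abs_of_nonneg hn, abs_of_nonneg (by positivity), pow_mul, Measure.real]
  congr 1
  ring

lemma abs_tprod_sinc_sub_le {q : ℝ} (hq0 : 0 < q) (hq1 : q < 1) (x y : ℝ) (hxy : y = x * (1 - q)) :
    |∏' s : ℕ, Real.sinc (y * q ^ s) - Real.sinc x| ≤ q / (1 - q) + 2 * q / (1 - q) := by
  have hgeo : Summable fun s : ℕ => |y| * q ^ s :=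
    (summable_geometric_of_lt_one hq0.le hq1).mul_left _
  have hb : ∀ s, |Real.sinc (y * q ^ s) - 1| ≤ |y| * q ^ s := fun s => by
    refine (abs_sinc_sub_one_le _).trans_eq ?_
    rw [abs_mul, abs_of_pos (pow_pos hq0 s)]
  have hsum : Summable fun s : ℕ => |Real.sinc (y * q ^ s) - 1| :=
    Summable.of_nonneg_of_le (fun _ => abs_nonneg _) hb hgeo
  have hsum1 : Summable fun s : ℕ => ‖Real.sinc (y * q ^ (s + 1)) - 1‖ :=
    (summable_nat_add_iff (f := fun s : ℕ => |Real.sinc (y * q ^ s) - 1|) 1).mpr hsum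
  have hmul : Multipliable fun s : ℕ => Real.sinc (y * q ^ (s + 1)) := by
    have := multipliable_one_add_of_summable (R := ℝ)
      (f := fun s : ℕ => Real.sinc (y * q ^ (s + 1)) - 1)
      hsum1
    refine this.congr fun s => ?_
    ring
  have hsplit : ∏' s : ℕ, Real.sinc (y * q ^ s)
      = Real.sinc y * ∏' s : ℕ, Real.sinc (y * q ^ (s + 1)) := by
    have h0 := tprod_eq_zero_mul' (f := fun s : ℕ => Real.sinc (y * q ^ s)) hmul
    rwa [pow_zero, mul_one] at h0
  have hQ : |∏' s : ℕ, Real.sinc (y * q ^ (s + 1)) - 1| ≤ |y| * (q / (1 - q)) := by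
    have hlim := (hmul.hasProd.sub_const 1).abs
    refine le_of_tendsto hlim (Eventually.of_forall fun S => ?_)
    refine (abs_prod_sub_one_le _ (fun s => Real.abs_sinc_le_one _) S).trans ?_
    have hgeo' : Summable fun s : ℕ => |y| * q ^ (s + 1) := 
      (summable_nat_add_iff (f := fun s : ℕ => |y| * q ^ s) 1).mpr hgeo
    refine (Finset.sum_le_sum fun s _ => hb (s + 1)).trans ?_
    refine (hgeo'.sum_le_tsum S fun s _ => by positivity).trans_eq ?_
    rw [tsum_mul_left]
    congr 1
    simp_rw [pow_succ]
    rw [tsum_mul_right, tsum_geometric_of_lt_one hq0.le hq1]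
    ring
  have hy : |Real.sinc y| * |y| ≤ 1 := by
    rcases eq_or_ne y 0 with hy | hy
    · simp [hy]
    · rw [Real.sinc_of_ne_zero hy, ← abs_mul, div_mul_cancel₀ _ hy]
      exact Real.abs_sin_le_one y
  have hfirst : |Real.sinc y * ∏' s : ℕ, Real.sinc (y * q ^ (s + 1)) - Real.sinc y|
      ≤ q / (1 - q) := by
    rw [← mul_sub_one, abs_mul]
    calc _ ≤ |Real.sinc y| * (|y| * (q / (1 - q))) :=
          mul_le_mul_of_nonneg_left hQ (abs_nonneg _)
      _ = (|Real.sinc y| * |y|) * (q / (1 - q)) := by ring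
      _ ≤ q / (1 - q) := mul_le_of_le_one_left (div_nonneg hq0.le (by linarith)) hy
  have hsecond : |Real.sinc y - Real.sinc x| ≤ 2 * q / (1 - q) := by
    have := abs_sinc_mul_sub_sinc_le (a := 1 - q) (by linarith) (by linarith) x
    rw [hxy]
    simpa using this
  rw [hsplit]
  exact (abs_sub_le _ (Real.sinc y) _).trans (add_le_add hfirst hsecond)

lemma abs_psiHat_sub_le (Ω : Set ℝ) {ε : ℝ} (h0 : 0 < ε) (h1 : ε < 1) {n : ℕ} (hn : n ≠ 0)
    (t : ℝ) :
    |psiHat Ω ε n t - Real.sinc (Real.pi * (t * volume.real Ω))| ≤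
      ε ^ n / (1 - ε ^ n) + 2 * ε ^ n / (1 - ε ^ n) := by
  rw [psiHat_eq Ω h0 h1]
  exact abs_tprod_sinc_sub_le (pow_pos h0 n) (pow_lt_one₀ h0.le h1 hn) _ _ rfl

theorem tendstoUniformly_psiHat (Ω : Set ℝ) {ε : ℝ} (h0 : 0 < ε) (h1 : ε < 1) :
    TendstoUniformly (psiHat Ω ε) (Psi Ω ε) atTop := by
  have hp : Tendsto (fun n : ℕ => ε ^ n) atTop (𝓝 0) :=
    tendsto_pow_atTop_nhds_zero_of_lt_one h0.le h1
  have hlim : Tendsto (fun n : ℕ => ε ^ n / (1 - ε ^ n) + 2 * ε ^ n / (1 - ε ^ n))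
      atTop (𝓝 0) := by
    have hd : Tendsto (fun n : ℕ => 1 - ε ^ n) atTop (𝓝 (1 - 0)) := hp.const_sub 1
    have := (hp.div hd (by norm_num)).add ((hp.const_mul 2).div hd (by norm_num))
    simpa using this
  have hunif : TendstoUniformly (psiHat Ω ε)
      (fun t => Real.sinc (Real.pi * (t * volume.real Ω))) atTop := by
    rw [Metric.tendstoUniformly_iff]
    intro δ hδ
    filter_upwards [hlim.eventually_lt_const hδ, eventually_ne_atTop 0] with n hn hn0 t
    rw [dist_comm, Real.dist_eq]
    exact (abs_psiHat_sub_le Ω h0 h1 hn0 t).trans_lt hn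
  have hPsi : Psi Ω ε = fun t => Real.sinc (Real.pi * (t * volume.real Ω)) := by
    funext t
    exact (hunif.tendsto_at t).limUnder_eq
  rwa [hPsi]

/-! ### Gabor systems, Bessel sequences and duality -/

/-- A family `e` is a Bessel sequence: `∑ᵢ |⟨f, eᵢ⟩|² ≤ B ‖f‖²` for all `f`, for some `B > 0`. -/
def IsBessel {m : ℕ} {ι : Type*} (e : ι → L2 m) : Prop :=
  ∃ B : ℝ, 0 < B ∧ ∀ f : L2 m,
    Summable (fun i => ‖inner ℂ (e i) f‖ ^ 2) ∧ ∑' i, ‖inner ℂ (e i) f‖ ^ 2 ≤ B * ‖f‖ ^ 2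

/-- The family `d` is dual to the family `e`: `f = ∑ᵢ ⟨f, eᵢ⟩ dᵢ` in `L²` for every `f`. The
product `⟨f, g⟩`, linear in `f`, is `inner ℂ g f` in Mathlib. -/
def IsDualSystem {m : ℕ} {ι : Type*} (d e : ι → L2 m) : Prop :=
  ∀ f : L2 m, HasSum (fun i => inner ℂ (e i) f • d i) f

/-- The vector `B v ∈ ℝ^m` for a real matrix `B` and `v ∈ ℤ^m`. -/
def latticePoint {m : ℕ} (B : Matrix (Fin m) (Fin m) ℝ) (v : Fin m → ℤ) : Eucl m :=
  WithLp.toLp 2 (B.mulVec fun i => (v i : ℝ))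

/-- The Gabor system `{T_λ M_{An} g_l : l = 1, …, L, λ ∈ Λ, n ∈ ℤ^m}`. -/
def gaborSystem {m L : ℕ} (g : Fin L → L2 m) (Λ : Set (Eucl m)) (A : Matrix (Fin m) (Fin m) ℝ) :
    Fin L × Λ × (Fin m → ℤ) → L2 m :=
  fun i => translation (i.2.1 : Eucl m) (modulation (latticePoint A i.2.2) (g i.1))

end

end ModelSetGabor

open ModelSetGabor

/-! Write sinc u = sin(πu)/(πu). The limit and the convolution are explicit: Ψ(t) = sinc(t|Ω|), and
sinc * sinc = sinc gives Φ = Ψ (`Psi_eq_sinc`, `Phi_eq_sinc`). As Ω = [-a, a], the number |Ω|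
Φ(-p₂*(η)) is the Fourier transform of the indicator of Ω at p₂*(η), while the density is |Ω| /
covol Γ (`hasDensity_modelSet`). The duality conditions are therefore conditions on Fourier
coefficients of Γ-periodic functions on ℝ^m × ℝ.

By the Bessel property the mixed frame operator S is bounded, and duality means S = id. This can be
tested on f, f' each supported in one cell of the lattice A⁻ᵀℤ^m. For such f, f', Parseval on a cell
carries out the sum over the frequencies An, and ⟨S T_{-x}f, T_{-x}f'⟩ becomes ∑ K(λ + x) over the
model set, where K is a finite sum of correlations (`hasSum_frequencies`, `hasSum_gaborKernel`).
This sum is the value at (x, 0) of the Γ-periodization of (y, s) ↦ 1_Ω(s) K(y). Its Fourier integral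
at η is the transform of 1_Ω at p₂*(η) times that of K at p₁*(η), and the latter contains the sum ∑
⟨T_{A⁻ᵀv} M h_l, g_l⟩ as a factor (`integral_gaborKernel_mul`).

If S = id, these matrix coefficients do not depend on x; conversely, it is enough to identify the
constant. The link is `periodized_eq_const_iff`: periodicity and density of p₂(Γ) spread a constant
from the slice ℝ^m × {0} to almost every point, and genericity makes s = 0 a point of continuity, so
that a constant can be brought back to the slice. A test pair adapted to (η, v) then isolates one
condition. -/

namespace ModelSetGabor

/-! ### Fourier series on a fundamental domain -/

section LatticeFourier

open Module ComplexConjugate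

attribute [local instance] instMeasureSpaceUnitAddCircle

variable {ι E : Type*} [Fintype ι] [NormedAddCommGroup E] [NormedSpace ℝ E]

/-- The character `x ↦ exp(2πi ∑ nᵢ xᵢ)`, where the `xᵢ` are the coordinates of `x` in the
basis `b`. -/
noncomputable def basisChar (b : Basis ι ℝ E) (n : ι → ℤ) (x : E) : ℂ :=
  Complex.exp (2 * Real.pi * Complex.I * ((∑ i, n i * b.repr x i : ℝ) : ℂ))

/-- The map from the torus `(ℝ/ℤ)^ι` onto (almost all of) the fundamental domain of a basis. -/
noncomputable def torusToDomain (b : Basis ι ℝ E) (x : UnitAddTorus ι) : E :=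
  b.equivFun.symm (UnitAddTorus.measurableEquivPiIoc (0 : ι → ℝ) x).1

lemma mFourier_eq_basisChar (b : Basis ι ℝ E) (n : ι → ℤ) (x : UnitAddTorus ι) :
    UnitAddTorus.mFourier n x = basisChar b n (torusToDomain b x) := by
  have hx : x = fun i => (((UnitAddTorus.measurableEquivPiIoc (0 : ι → ℝ) x).1 i : ℝ) :
      UnitAddCircle) := by
    conv_lhs => rw [← (UnitAddTorus.measurableEquivPiIoc (0 : ι → ℝ)).symm_apply_apply x]
    rfl
  conv_lhs => rw [hx]
  have h : ∀ i, b.repr (torusToDomain b x) i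
      = (UnitAddTorus.measurableEquivPiIoc (0 : ι → ℝ) x).1 i := fun i => by
    rw [torusToDomain, ← b.equivFun_apply, LinearEquiv.apply_symm_apply]
  simp only [basisChar, h, UnitAddTorus.mFourier, ContinuousMap.coe_mk, fourier_coe_apply]
  rw [← Complex.exp_sum]
  congr 1
  push_cast
  rw [Finset.mul_sum]
  refine Finset.sum_congr rfl fun i _ => ?_
  simp
  ring

variable [MeasurableSpace E] [BorelSpace E]

/-- The image of Lebesgue measure under the coordinate isomorphism is a Haar measure giving the
fundamental domain mass one. By uniqueness of Haar measure μ is a multiple of it, and evaluation on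
the domain identifies the factor. -/
lemma measurePreserving_torusToDomain [FiniteDimensional ℝ E] (b : Basis ι ℝ E) (μ : Measure E)
    [μ.IsAddHaarMeasure] :
    MeasurePreserving (torusToDomain b) volume
      ((μ (ZSpan.fundamentalDomain b))⁻¹ • μ.restrict (ZSpan.fundamentalDomain b)) := by
  have h1 : MeasurePreserving
      (fun x => (UnitAddTorus.measurableEquivPiIoc (0 : ι → ℝ) x).1) volume
      (volume.restrict (Set.univ.pi fun _ : ι => Set.Ico (0 : ℝ) 1)) := by
    have hs : {x : ι → ℝ | ∀ i, x i ∈ Set.Ioc ((0 : ι → ℝ) i) ((0 : ι → ℝ) i + 1)}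
        = Set.univ.pi fun _ : ι => Set.Ioc (0 : ℝ) 1 := by
      ext x; simp
    have hm : MeasurableSet {x : ι → ℝ | ∀ i, x i ∈ Set.Ioc ((0 : ι → ℝ) i) ((0 : ι → ℝ) i + 1)} := by
      rw [hs]; exact MeasurableSet.univ_pi fun _ => measurableSet_Ioc
    have h := (MeasurePreserving.mk measurable_subtype_coe rfl :
      MeasurePreserving (Subtype.val : {x : ι → ℝ // ∀ i, x i ∈ Set.Ioc ((0 : ι → ℝ) i)
        ((0 : ι → ℝ) i + 1)} → ι → ℝ) (Measure.comap Subtype.val volume) _).comp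
      (UnitAddTorus.measurePreserving_equivPiIoc (0 : ι → ℝ))
    have e : Measure.map (Subtype.val : {x : ι → ℝ // ∀ i, x i ∈ Set.Ioc ((0 : ι → ℝ) i)
        ((0 : ι → ℝ) i + 1)} → ι → ℝ) (Measure.comap Subtype.val volume) =
        volume.restrict (Set.univ.pi fun _ : ι => Set.Ico (0 : ℝ) 1) := by
      refine (map_comap_subtype_coe hm volume).trans ?_
      rw [hs]
      -- The torus is represented by left-open boxes, the fundamental domain by right-open ones;
      -- they differ by a null set.
      refine Measure.restrict_congr_set ?_
      exact Measure.univ_pi_Ioc_ae_eq_Icc.trans Measure.univ_pi_Ico_ae_eq_Icc.symm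
    rw [e] at h
    exact h
  set T : (ι → ℝ) ≃L[ℝ] E := b.equivFun.symm.toContinuousLinearEquiv with hT
  have hTm : MeasurableEmbedding T := T.toHomeomorph.measurableEmbedding
  have hpre : T ⁻¹' ZSpan.fundamentalDomain b = Set.univ.pi fun _ : ι => Set.Ico (0 : ℝ) 1 := by
    ext x
    simp only [Set.mem_preimage, ZSpan.mem_fundamentalDomain, Set.mem_univ_pi]
    refine forall_congr' fun i => ?_
    have : b.repr (T x) i = x i := by
      rw [← b.equivFun_apply]
      exact congrFun (b.equivFun.apply_symm_apply x) i
    rw [this]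
  have hν : Measure.map T (volume : Measure (ι → ℝ)) (ZSpan.fundamentalDomain b) = 1 := by
    rw [hTm.map_apply, hpre, volume_pi_pi]
    simp
  have : (Measure.map T (volume : Measure (ι → ℝ))).IsAddHaarMeasure :=
    ContinuousLinearEquiv.isAddHaarMeasure_map T volume
  have hμ := Measure.isAddLeftInvariant_eq_smul μ (Measure.map T volume)
  set k := μ.addHaarScalarFactor (Measure.map T volume) with hk
  have hc : μ (ZSpan.fundamentalDomain b) = k := by
    rw [hμ, Measure.smul_apply, hν]; simp [ENNReal.smul_def]
  have hk0 : (k : ℝ≥0∞) ≠ 0 := by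
    rw [← hc]; exact ZSpan.measure_fundamentalDomain_ne_zero b
  have h2 : MeasurePreserving T (volume.restrict (Set.univ.pi fun _ : ι => Set.Ico (0 : ℝ) 1))
      ((μ (ZSpan.fundamentalDomain b))⁻¹ • μ.restrict (ZSpan.fundamentalDomain b)) := by
    refine ⟨hTm.measurable, ?_⟩
    rw [hc]
    conv_rhs => rw [hμ]
    rw [← hpre, ← hTm.restrict_map, Measure.restrict_smul]
    refine Measure.ext fun s _ => ?_
    rw [Measure.smul_apply, Measure.smul_apply, ENNReal.smul_def, smul_eq_mul, smul_eq_mul,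
      ← mul_assoc, ENNReal.inv_mul_cancel hk0 ENNReal.coe_ne_top, one_mul]
  exact h2.comp h1

lemma measurableEmbedding_torusToDomain (b : Basis ι ℝ E) :
    MeasurableEmbedding (torusToDomain b) := by
  have : FiniteDimensional ℝ E := b.finiteDimensional_of_finite
  have hs : MeasurableSet {x : ι → ℝ | ∀ i, x i ∈ Set.Ioc ((0 : ι → ℝ) i) ((0 : ι → ℝ) i + 1)} := by
    have hs : {x : ι → ℝ | ∀ i, x i ∈ Set.Ioc ((0 : ι → ℝ) i) ((0 : ι → ℝ) i + 1)}
        = Set.univ.pi fun _ : ι => Set.Ioc (0 : ℝ) 1 := by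
      ext x; simp
    rw [hs]; exact MeasurableSet.univ_pi fun _ => measurableSet_Ioc
  exact b.equivFun.symm.toContinuousLinearEquiv.toHomeomorph.measurableEmbedding.comp
    ((MeasurableEmbedding.subtype_coe hs).comp
      (UnitAddTorus.measurableEquivPiIoc (0 : ι → ℝ)).measurableEmbedding)

section

variable [FiniteDimensional ℝ E] (b : Basis ι ℝ E) (μ : Measure E) [μ.IsAddHaarMeasure]

omit [BorelSpace E] in
lemma measure_fundamentalDomain_ne_top : μ (ZSpan.fundamentalDomain b) ≠ ∞ :=
  (ZSpan.fundamentalDomain_isBounded b).measure_lt_top.ne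

lemma measureReal_fundamentalDomain_pos : 0 < μ.real (ZSpan.fundamentalDomain b) :=
  ENNReal.toReal_pos (ZSpan.measure_fundamentalDomain_ne_zero b)
    (measure_fundamentalDomain_ne_top b μ)

lemma integral_comp_torusToDomain (F : E → ℂ) :
    ∫ x, F (torusToDomain b x)
      = ((μ.real (ZSpan.fundamentalDomain b) : ℝ) : ℂ)⁻¹ * ∫ x in ZSpan.fundamentalDomain b, F x ∂μ := by
  rw [(measurePreserving_torusToDomain b μ).integral_comp (measurableEmbedding_torusToDomain b),
    integral_smul_measure, ENNReal.toReal_inv, Complex.real_smul]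
  push_cast
  rfl

lemma memLp_comp_torusToDomain {F : E → ℂ} (hF : MemLp F 2 (μ.restrict (ZSpan.fundamentalDomain b))) :
    MemLp (fun x => F (torusToDomain b x)) 2 volume := by
  refine MemLp.comp_measurePreserving ?_ (measurePreserving_torusToDomain b μ)
  exact hF.smul_measure (ENNReal.inv_ne_top.2 (ZSpan.measure_fundamentalDomain_ne_zero b))

/-- Parseval's identity for Fourier series on the fundamental domain of a basis. -/
theorem hasSum_fourier_fundamentalDomain {F H : E → ℂ}
    (hF : MemLp F 2 (μ.restrict (ZSpan.fundamentalDomain b)))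
    (hH : MemLp H 2 (μ.restrict (ZSpan.fundamentalDomain b))) :
    HasSum (fun n : ι → ℤ =>
      (∫ x in ZSpan.fundamentalDomain b, F x * conj (basisChar b n x) ∂μ) *
        conj (∫ x in ZSpan.fundamentalDomain b, H x * conj (basisChar b n x) ∂μ))
      (μ.real (ZSpan.fundamentalDomain b) *
        ∫ x in ZSpan.fundamentalDomain b, F x * conj (H x) ∂μ) := by
  have hF' := memLp_comp_torusToDomain b μ hF
  have hH' := memLp_comp_torusToDomain b μ hH
  -- The Parseval formula on the torus conjugates its first argument, hence the order H, F.
  have key := UnitAddTorus.hasSum_prod_mFourierCoeff (hH'.toLp _) (hF'.toLp _)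
  have hcoef : ∀ {K : E → ℂ} (hK : MemLp (fun x => K (torusToDomain b x)) 2 volume) (n : ι → ℤ),
      UnitAddTorus.mFourierCoeff (hK.toLp _) n = ((μ.real (ZSpan.fundamentalDomain b) : ℝ) : ℂ)⁻¹ *
        ∫ x in ZSpan.fundamentalDomain b, K x * conj (basisChar b n x) ∂μ := by
    intro K hK n
    rw [← integral_comp_torusToDomain, UnitAddTorus.mFourierCoeff]
    refine integral_congr_ae ?_
    filter_upwards [hK.coeFn_toLp] with x hx
    rw [hx, UnitAddTorus.mFourier_neg, mFourier_eq_basisChar b, smul_eq_mul, mul_comm]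
  have hint : ∫ t, conj ((hH'.toLp _) t) * (hF'.toLp _) t = ((μ.real (ZSpan.fundamentalDomain b) : ℝ) : ℂ)⁻¹ *
      ∫ x in ZSpan.fundamentalDomain b, F x * conj (H x) ∂μ := by
    rw [← integral_comp_torusToDomain b μ (fun x => F x * conj (H x))]
    refine integral_congr_ae ?_
    filter_upwards [hF'.coeFn_toLp, hH'.coeFn_toLp] with x hx hy
    rw [hx, hy, mul_comm]
  simp only [hcoef] at key
  rw [hint] at key
  have hc : ((μ.real (ZSpan.fundamentalDomain b) : ℝ) : ℂ) ≠ 0 := by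
    exact_mod_cast (measureReal_fundamentalDomain_pos b μ).ne'
  -- Each of the two coefficients carries a factor 1/vol and so does the integral; multiplication by
  -- vol² leaves a single vol on the right.
  have key2 := key.mul_left (((μ.real (ZSpan.fundamentalDomain b) : ℝ) : ℂ) ^ 2)
  convert key2 using 1
  · rfl
  · funext n
    simp only [map_mul, map_inv₀, Complex.conj_ofReal]
    field_simp
  · field_simp

/-- A square-integrable function on a fundamental domain whose Fourier coefficients vanish is
almost everywhere zero. -/
theorem ae_eq_zero_of_fourier_eq_zero {F : E → ℂ}
    (hF : MemLp F 2 (μ.restrict (ZSpan.fundamentalDomain b)))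
    (h0 : ∀ n, ∫ x in ZSpan.fundamentalDomain b, F x * conj (basisChar b n x) ∂μ = 0) :
    ∀ᵐ x ∂μ.restrict (ZSpan.fundamentalDomain b), F x = 0 := by
  have key := hasSum_fourier_fundamentalDomain b μ hF hF
  simp only [h0, zero_mul] at key
  have h1 := key.unique hasSum_zero
  have hc : ((μ.real (ZSpan.fundamentalDomain b) : ℝ) : ℂ) ≠ 0 := by
    exact_mod_cast (measureReal_fundamentalDomain_pos b μ).ne'
  have h2 := (mul_eq_zero.1 h1).resolve_left hc
  have h3 : ∫ x in ZSpan.fundamentalDomain b, ‖F x‖ ^ 2 ∂μ = 0 := by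
    have : ∀ x, F x * conj (F x) = ((‖F x‖ ^ 2 : ℝ) : ℂ) := fun x => by
      rw [Complex.mul_conj, Complex.normSq_eq_norm_sq]
    simp only [this] at h2
    rw [integral_complex_ofReal] at h2
    exact_mod_cast h2
  rw [integral_eq_zero_iff_of_nonneg (fun x => by positivity) (hF.integrable_norm_pow two_ne_zero)] at h3
  filter_upwards [h3] with x hx
  simpa using hx

/-- Orthogonality of the monomials to the constant 1 on the torus. -/
theorem integral_basisChar (n : ι → ℤ) :
    ∫ x in ZSpan.fundamentalDomain b, conj (basisChar b n x) ∂μ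
      = if n = 0 then ((μ.real (ZSpan.fundamentalDomain b) : ℝ) : ℂ) else 0 := by
  have hc : ((μ.real (ZSpan.fundamentalDomain b) : ℝ) : ℂ) ≠ 0 := by
    exact_mod_cast (measureReal_fundamentalDomain_pos b μ).ne'
  have h := integral_comp_torusToDomain b μ (fun x => conj (basisChar b n x))
  have h1 : ∫ x, conj (basisChar b n (torusToDomain b x)) = if n = 0 then 1 else 0 := by
    have := orthonormal_iff_ite.1 (UnitAddTorus.orthonormal_mFourier (d := ι)) n 0
    rw [ContinuousMap.inner_toLp] at this
    rw [← this]
    refine integral_congr_ae (Eventually.of_forall fun x => ?_)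
    simp [mFourier_eq_basisChar b, UnitAddTorus.mFourier_zero]
  rw [h1] at h
  rw [eq_comm, inv_mul_eq_iff_eq_mul₀ hc] at h
  rw [h]
  split_ifs <;> simp

end

end LatticeFourier
-- The functions Ψ and Φ are sinc functions
section Sinc

open Module ComplexConjugate

/-- Unfolding of an integral over a fundamental domain. -/
theorem integral_eq_setIntegral_tsum_vadd {G α : Type*} [AddGroup G] [AddAction G α]
    [MeasurableSpace α] [Countable G] {μ : Measure α} [MeasurableConstVAdd G α]
    [VAddInvariantMeasure G α μ] {s : Set α} (h : IsAddFundamentalDomain G s μ) {p : α → ℂ}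
    (hp : Integrable p μ) :
    ∫ x, p x ∂μ = ∫ x in s, ∑' γ : G, p (γ +ᵥ x) ∂μ := by
  rw [h.integral_eq_tsum'' p hp, integral_tsum]
  · intro γ
    exact ((hp.1.comp_measurePreserving (measurePreserving_vadd γ μ)).mono_measure
      Measure.restrict_le_self)
  · rw [← h.lintegral_eq_tsum'' (fun x => ‖p x‖ₑ)]
    exact hp.2.ne

/-- Factoring out the phase at the midpoint leaves the sine of a real argument; for a symmetric
interval that phase is 1. -/
lemma intervalIntegral_exp_eq_sinc (t c d : ℝ) :
    ∫ x in c..d, Complex.exp (2 * Real.pi * Complex.I * ((t * x : ℝ) : ℂ))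
      = ((d - c : ℝ) : ℂ) * Complex.exp (Real.pi * Complex.I * ((t * (c + d) : ℝ) : ℂ)) *
        (Real.sinc (Real.pi * (t * (d - c))) : ℂ) := by
  rcases eq_or_ne t 0 with rfl | ht
  · simp
  rcases eq_or_ne c d with rfl | hcd
  · simp
  have hdc : d - c ≠ 0 := sub_ne_zero.2 hcd.symm
  have hpi : Real.pi ≠ 0 := Real.pi_ne_zero
  have hk : (2 * Real.pi * Complex.I * t : ℂ) ≠ 0 := by
    simp [ht, hpi]
  have h1 : ∀ x : ℝ, (2 * Real.pi * Complex.I * ((t * x : ℝ) : ℂ))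
      = (2 * Real.pi * Complex.I * t) * x := fun x => by push_cast; ring
  simp only [h1]
  rw [integral_exp_mul_complex hk, Real.sinc_of_ne_zero (by positivity)]
  push_cast
  rw [Complex.sin]
  have e1 : (2 * Real.pi * Complex.I * t * d : ℂ)
      = Real.pi * Complex.I * (t * (c + d)) + Real.pi * (t * (d - c)) * Complex.I := by ring
  have e2 : (2 * Real.pi * Complex.I * t * c : ℂ)
      = Real.pi * Complex.I * (t * (c + d)) + -(Real.pi * (t * (d - c))) * Complex.I := by ring
  rw [e1, e2, Complex.exp_add, Complex.exp_add]
  have htc : (t : ℂ) ≠ 0 := by exact_mod_cast ht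
  have hpc : (Real.pi : ℂ) ≠ 0 := by exact_mod_cast hpi
  have hdcc : (d - c : ℂ) ≠ 0 := by exact_mod_cast hdc
  have hI := Complex.I_mul_I
  field_simp
  rw [Complex.I_sq]
  ring

/-- Sum of sinc² ≤ 1 and x² sinc² ≤ 1; it supplies an integrable majorant. -/
lemma sq_sinc_le (x : ℝ) : Real.sinc x ^ 2 ≤ 2 * (1 + x ^ 2)⁻¹ := by
  rcases eq_or_ne x 0 with rfl | hx
  · simp
  have h1 : Real.sinc x ^ 2 ≤ 1 := (sq_le_one_iff_abs_le_one _).2 (Real.abs_sinc_le_one x)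
  have h2 : Real.sinc x ^ 2 * x ^ 2 ≤ 1 := by
    rw [Real.sinc_of_ne_zero hx, ← mul_pow, div_mul_cancel₀ _ hx]
    exact Real.sin_sq_le_one x
  rw [← div_eq_mul_inv, le_div_iff₀ (by positivity)]
  linarith

lemma integrable_sinc_mul_sinc (t : ℝ) :
    Integrable fun u : ℝ => Real.sinc (Real.pi * u) * Real.sinc (Real.pi * (t - u)) := by
  have h0 : Integrable fun u : ℝ => Real.sinc (Real.pi * u) ^ 2 := by
    refine Integrable.mono' ((integrable_inv_one_add_sq.const_mul 2).comp_mul_left'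
      Real.pi_ne_zero) (by fun_prop) (Eventually.of_forall fun u => ?_)
    rw [Real.norm_eq_abs, abs_of_nonneg (sq_nonneg _)]
    exact sq_sinc_le _
  have h1 := h0.comp_sub_left t
  refine Integrable.mono' (h0.add h1) (by fun_prop) (Eventually.of_forall fun u => ?_)
  rw [Real.norm_eq_abs, abs_le]
  simp only [Pi.add_apply]
  constructor <;>
  nlinarith [sq_nonneg (Real.sinc (Real.pi * u) - Real.sinc (Real.pi * (t - u))),
    sq_nonneg (Real.sinc (Real.pi * u) + Real.sinc (Real.pi * (t - u)))]

/-- Parseval on [0, 1) for the exponentials with the real frequencies s and t: their coefficients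
and their inner product are, up to phases, values of sinc. -/
lemma tsum_sinc_mul_sinc (s t : ℝ) :
    HasSum (fun n : Unit → ℤ => Real.sinc (Real.pi * (s + n ())) * Real.sinc (Real.pi * (t + n ())))
      (Real.sinc (Real.pi * (s - t))) := by
  set b : Basis Unit ℝ ℝ := Basis.singleton Unit ℝ with hb
  have hD : ZSpan.fundamentalDomain b = Set.Ico (0 : ℝ) 1 := by
    ext x; simp [ZSpan.mem_fundamentalDomain, hb]
  have hint : ∀ r : ℝ, ∫ x in Set.Ico (0 : ℝ) 1,
      Complex.exp (2 * Real.pi * Complex.I * ((r * x : ℝ) : ℂ))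
      = Complex.exp (Real.pi * Complex.I * r) * (Real.sinc (Real.pi * r) : ℂ) := by
    intro r
    have := intervalIntegral_exp_eq_sinc r 0 1
    rw [intervalIntegral.integral_of_le zero_le_one, ← integral_Ico_eq_integral_Ioc] at this
    rw [this]; simp
  have hmem : ∀ r : ℝ, MemLp (fun x : ℝ => Complex.exp (2 * Real.pi * Complex.I * ((r * x : ℝ) : ℂ)))
      2 (volume.restrict (ZSpan.fundamentalDomain b)) := by
    intro r
    rw [hD]
    refine MemLp.of_bound (by fun_prop) 1 (Eventually.of_forall fun x => ?_)
    have h : 2 * Real.pi * Complex.I * ((r * x : ℝ) : ℂ)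
      = ((2 * Real.pi * (r * x) : ℝ) : ℂ) * Complex.I := by push_cast; ring
    rw [h, Complex.norm_exp_ofReal_mul_I]
  have hconj : ∀ r : ℝ, conj (Complex.exp (2 * Real.pi * Complex.I * (r : ℂ)))
      = Complex.exp (2 * Real.pi * Complex.I * ((-r : ℝ) : ℂ)) := by
    intro r
    rw [← Complex.exp_conj]
    simp [map_ofNat]
  have key := hasSum_fourier_fundamentalDomain b volume (hmem s) (hmem t)
  have hcoef : ∀ (r : ℝ) (n : Unit → ℤ), ∫ x in ZSpan.fundamentalDomain b,
      Complex.exp (2 * Real.pi * Complex.I * ((r * x : ℝ) : ℂ)) * conj (basisChar b n x)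
      = Complex.exp (Real.pi * Complex.I * (r - n () : ℝ)) *
        (Real.sinc (Real.pi * (r - n ())) : ℂ) := by
    intro r n
    rw [hD, ← hint]
    refine integral_congr_ae (Eventually.of_forall fun x => ?_)
    simp only [basisChar, hconj, ← Complex.exp_add]
    congr 1
    simp [hb]
    ring
  have hfin : ∫ x in ZSpan.fundamentalDomain b,
      Complex.exp (2 * Real.pi * Complex.I * ((s * x : ℝ) : ℂ)) *
        conj (Complex.exp (2 * Real.pi * Complex.I * ((t * x : ℝ) : ℂ)))
      = Complex.exp (Real.pi * Complex.I * (s - t : ℝ)) *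
        (Real.sinc (Real.pi * (s - t)) : ℂ) := by
    rw [hD, ← hint]
    refine integral_congr_ae (Eventually.of_forall fun x => ?_)
    simp only [hconj, ← Complex.exp_add]
    congr 1
    push_cast
    ring
  simp only [hcoef] at key
  rw [hfin] at key
  have hv : (volume.real (ZSpan.fundamentalDomain b) : ℝ) = 1 := by
    rw [hD]; simp
  rw [hv] at key
  -- Every term and the sum carry the same phase exp(πi(s - t)), which is divided out; n ↦ -n turns
  -- s - n into s + n.
  have key2 := key.mul_left (Complex.exp (-(Real.pi * Complex.I * (s - t : ℝ))))
  have key3 := (Equiv.neg (Unit → ℤ)).hasSum_iff.2 key2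
  rw [← Complex.hasSum_ofReal]
  convert key3 using 1
  · rfl
  · funext n
    simp only [Function.comp_apply, Equiv.neg_apply, Pi.neg_apply, map_mul, Complex.conj_ofReal,
      ← Complex.exp_conj]
    have : ∀ A B C D E : ℂ, A * ((B * D) * (C * E)) = (A * B * C) * (D * E) := by
      intros; ring
    rw [this, ← Complex.exp_add, ← Complex.exp_add]
    have hz : ∀ z : ℂ, z = 0 → Complex.exp z = 1 := fun z hz => by rw [hz, Complex.exp_zero]
    rw [hz]
    · push_cast; simp
    · simp; ring
  · rw [Complex.ofReal_one, one_mul, ← mul_assoc, ← Complex.exp_add]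
    simp

/-- The integral over ℝ is unfolded to [0, 1), where the sum over integer translates is the constant
given by `tsum_sinc_mul_sinc`. On the Fourier side this says that an indicator function is
idempotent. -/
lemma integral_sinc_mul_sinc (t : ℝ) :
    ∫ u : ℝ, Real.sinc (Real.pi * u) * Real.sinc (Real.pi * (t - u)) = Real.sinc (Real.pi * t) := by
  set b : Basis Unit ℝ ℝ := Basis.singleton Unit ℝ with hb
  have hD : ZSpan.fundamentalDomain b = Set.Ico (0 : ℝ) 1 := by
    ext x; simp [ZSpan.mem_fundamentalDomain, hb]
  have hfd := ZSpan.isAddFundamentalDomain b (volume : Measure ℝ)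
  have hsum : ∀ x : ℝ, HasSum (fun γ : Submodule.span ℤ (Set.range b) =>
      Real.sinc (Real.pi * ((γ : ℝ) + x)) * Real.sinc (Real.pi * (t - ((γ : ℝ) + x))))
      (Real.sinc (Real.pi * t)) := by
    intro x
    -- Since sinc is even, the factor at t - (n + x) equals the one at (x - t) + n, and x - (x - t)
    -- = t.
    have h := tsum_sinc_mul_sinc x (x - t)
    rw [sub_sub_cancel] at h
    rw [← (b.restrictScalars ℤ).equivFun.symm.toEquiv.hasSum_iff]
    convert h using 1
    funext n
    have : (((b.restrictScalars ℤ).equivFun.symm n : Submodule.span ℤ (Set.range b)) : ℝ) = n () := by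
      simp [Basis.equivFun_symm_apply, hb]
    simp only [Function.comp_apply, LinearEquiv.coe_toEquiv, this]
    rw [add_comm x, ← Real.sinc_neg (Real.pi * (t - _))]
    congr 2
    ring
  have : VAddInvariantMeasure (Submodule.span ℤ (Set.range b)) ℝ volume :=
    (inferInstance : VAddInvariantMeasure (Submodule.span ℤ (Set.range b)).toAddSubgroup ℝ volume)
  have h1 := integral_eq_setIntegral_tsum_vadd hfd (integrable_sinc_mul_sinc t).ofReal
  have h2 : ∀ x : ℝ, ∑' γ : Submodule.span ℤ (Set.range b),
      ((Real.sinc (Real.pi * (γ +ᵥ x)) * Real.sinc (Real.pi * (t - (γ +ᵥ x))) : ℝ) : ℂ)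
      = (Real.sinc (Real.pi * t) : ℝ) := fun x => by
    refine HasSum.tsum_eq ?_
    rw [Complex.hasSum_ofReal]
    exact hsum x
  simp only [RCLike.ofReal_eq_complex_ofReal] at h1
  simp only [h2] at h1
  rw [hD, integral_complex_ofReal] at h1
  simpa using h1

/-- The factor s = 0 tends to the sinc function of t|Ω|, and the remaining product does not matter
in the limit; `abs_psiHat_sub_le` bounds the error by a quantity tending to 0. -/
theorem Psi_eq_sinc (Ω : Set ℝ) {ε : ℝ} (h0 : 0 < ε) (h1 : ε < 1) (t : ℝ) :
    Psi Ω ε t = Real.sinc (Real.pi * (t * volume.real Ω)) := by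
  have hp : Tendsto (fun n : ℕ => ε ^ n) atTop (𝓝 0) :=
    tendsto_pow_atTop_nhds_zero_of_lt_one h0.le h1
  have hlim : Tendsto (fun n : ℕ => ε ^ n / (1 - ε ^ n) + 2 * ε ^ n / (1 - ε ^ n))
      atTop (𝓝 0) := by
    have hd : Tendsto (fun n : ℕ => 1 - ε ^ n) atTop (𝓝 (1 - 0)) := hp.const_sub 1
    have := (hp.div hd (by norm_num)).add ((hp.const_mul 2).div hd (by norm_num))
    simpa using this
  refine Tendsto.limUnder_eq (tendsto_iff_norm_sub_tendsto_zero.2 ?_)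
  refine squeeze_zero' (Eventually.of_forall fun _ => norm_nonneg _) ?_ hlim
  filter_upwards [eventually_ne_atTop 0] with n hn
  exact abs_psiHat_sub_le Ω h0 h1 hn t

/-- The substitution v = u|Ω| absorbs the factor |Ω| and leaves sinc * sinc = sinc. -/
theorem Phi_eq_sinc (Ω : Set ℝ) (hΩ : 0 < volume.real Ω) {ε : ℝ} (h0 : 0 < ε) (h1 : ε < 1)
    (t : ℝ) : Phi Ω ε t = Real.sinc (Real.pi * (t * volume.real Ω)) := by
  simp only [Phi, Psi_eq_sinc Ω h0 h1]
  set a := volume.real Ω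
  rw [← integral_sinc_mul_sinc (t * a)]
  have := Measure.integral_comp_mul_right
    (fun v => Real.sinc (Real.pi * v) * Real.sinc (Real.pi * (t * a - v))) a
  simp only [sub_mul]
  rw [this, abs_of_pos (inv_pos.2 hΩ), smul_eq_mul, ← mul_assoc, mul_inv_cancel₀ hΩ.ne', one_mul]

end Sinc
-- Density of the model set
section Density

open Module

/-- A compact connected set is some [c, d]; symmetry forces c = -d, and c = d is excluded because
the interior would be empty. -/
lemma IsIntervalWindow.eq_Icc {Ω : Set ℝ} (hΩ : IsIntervalWindow Ω) (hsymm : ∀ x ∈ Ω, -x ∈ Ω) :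
    ∃ a : ℝ, 0 < a ∧ Ω = Set.Icc (-a) a := by
  have h := eq_Icc_of_connected_compact
    ⟨hΩ.nonempty, hΩ.ordConnected.isPreconnected⟩ hΩ.isCompact
  set c := sInf Ω
  set d := sSup Ω
  have hne := hΩ.nonempty
  have hcl := hΩ.closure_interior
  rw [h] at hne hcl
  have hcd := Set.nonempty_Icc.1 hne
  have h1 : -d ∈ Ω := hsymm d (by rw [h]; exact Set.right_mem_Icc.2 hcd)
  have h2 : -c ∈ Ω := hsymm c (by rw [h]; exact Set.left_mem_Icc.2 hcd)
  rw [h] at h1 h2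
  have hc : c = -d := by linarith [h1.1, h2.2]
  have hlt : c < d := by
    refine lt_of_le_of_ne hcd fun he => ?_
    rw [interior_Icc, he, Set.Ioo_self, closure_empty] at hcl
    rw [Set.Icc_self] at hcl
    exact (Set.singleton_ne_empty d) hcl.symm
  refine ⟨d, by linarith, ?_⟩
  rw [h, hc]

lemma cube_eq_preimage {m : ℕ} (x : Eucl m) (R : ℝ) :
    cube x R = (MeasurableEquiv.toLp 2 (Fin m → ℝ)).symm ⁻¹'
      (Set.univ.pi fun i => Set.Icc (x i) (x i + R)) := by
  ext t
  simp [cube, -Set.pi_univ_Icc]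

lemma measurableSet_cube {m : ℕ} (x : Eucl m) (R : ℝ) : MeasurableSet (cube x R) := by
  rw [cube_eq_preimage]
  exact (MeasurableSet.univ_pi fun _ => measurableSet_Icc).preimage
    (MeasurableEquiv.toLp 2 (Fin m → ℝ)).symm.measurable

lemma volume_cube {m : ℕ} (x : Eucl m) (R : ℝ) :
    volume (cube x R) = ENNReal.ofReal R ^ m := by
  rw [cube_eq_preimage, (EuclideanSpace.volume_preserving_symm_measurableEquiv_toLp
    (Fin m)).measure_preimage_equiv, volume_pi_pi]
  simp

lemma isBounded_cube {m : ℕ} (x : Eucl m) (R : ℝ) : Bornology.IsBounded (cube x R) := by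
  have h : cube x R = (PiLp.homeomorph 2 fun _ : Fin m => ℝ) ⁻¹'
      (Set.univ.pi fun i => Set.Icc (x i) (x i + R)) := by
    ext t
    simp [cube, -Set.pi_univ_Icc, PiLp.homeomorph]
  have hc : IsCompact (cube x R) := by
    rw [h, Homeomorph.isCompact_preimage]
    exact isCompact_univ_pi fun _ => isCompact_Icc
  exact hc.isBounded

variable {m : ℕ} (Γ : Submodule ℤ (Eucl m × ℝ)) [DiscreteTopology Γ] [IsZLattice ℝ Γ]

lemma finite_lattice_inter {S : Set (Eucl m × ℝ)} (hS : Bornology.IsBounded S) :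
    (S ∩ (Γ : Set (Eucl m × ℝ))).Finite := by
  have h := ZSpan.setFinite_inter ((Free.chooseBasis ℤ Γ).ofZLatticeBasis ℝ) hS
  rwa [Basis.ofZLatticeBasis_span] at h

/-- The number of points of `Γ` in a set. -/
noncomputable def latticeCount (S : Set (Eucl m × ℝ)) : ℝ≥0∞ :=
  ∑' γ : Γ, S.indicator 1 (γ : Eucl m × ℝ)

omit [DiscreteTopology Γ] [IsZLattice ℝ Γ] in
-- The count for the translate Γ + z is compared with that for Γ by putting a lattice point γ₀ in
-- place of z; adding γ₀ only permutes Γ.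
lemma latticeCount_le_of_shift {S S' : Set (Eucl m × ℝ)} (z : Eucl m × ℝ) (γ₀ : Γ)
    (h : ∀ γ : Γ, (γ : Eucl m × ℝ) + z ∈ S → (γ : Eucl m × ℝ) + γ₀ ∈ S') :
    ∑' γ : Γ, S.indicator (1 : Eucl m × ℝ → ℝ≥0∞) (γ +ᵥ z) ≤ latticeCount Γ S' := by
  rw [latticeCount, ← (Equiv.addRight γ₀).tsum_eq (fun γ : Γ => S'.indicator 1 (γ : Eucl m × ℝ))]
  refine ENNReal.tsum_le_tsum fun γ => ?_
  by_cases hγ : (γ : Eucl m × ℝ) + z ∈ S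
  · have h1 : γ +ᵥ z ∈ S := hγ
    have h2 : ((Equiv.addRight γ₀ γ : Γ) : Eucl m × ℝ) ∈ S' := h γ hγ
    rw [Set.indicator_of_mem h1, Set.indicator_of_mem h2]
    exact le_rfl
  · have h1 : γ +ᵥ z ∉ S := hγ
    rw [Set.indicator_of_notMem h1]
    exact zero_le

omit [DiscreteTopology Γ] [IsZLattice ℝ Γ] in
lemma latticeCount_ge_of_shift {S S' : Set (Eucl m × ℝ)} (z : Eucl m × ℝ) (γ₀ : Γ)
    (h : ∀ γ : Γ, (γ : Eucl m × ℝ) + γ₀ ∈ S' → (γ : Eucl m × ℝ) + z ∈ S) :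
    latticeCount Γ S' ≤ ∑' γ : Γ, S.indicator (1 : Eucl m × ℝ → ℝ≥0∞) (γ +ᵥ z) := by
  rw [latticeCount, ← (Equiv.addRight γ₀).tsum_eq]
  refine ENNReal.tsum_le_tsum fun γ => ?_
  by_cases hγ : (γ : Eucl m × ℝ) + γ₀ ∈ S'
  · have h1 : γ +ᵥ z ∈ S := h γ hγ
    have h2 : ((Equiv.addRight γ₀ γ : Γ) : Eucl m × ℝ) ∈ S' := hγ
    rw [Set.indicator_of_mem h1, Set.indicator_of_mem h2]
    exact le_rfl
  · have h1 : ((Equiv.addRight γ₀ γ : Γ) : Eucl m × ℝ) ∉ S' := hγ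
    rw [Set.indicator_of_notMem h1]
    exact zero_le

instance isAddHaarMeasure_volume_prod (m : ℕ) :
    (volume : Measure (Eucl m × ℝ)).IsAddHaarMeasure :=
  inferInstanceAs ((volume : Measure (Eucl m)).prod (volume : Measure ℝ)).IsAddHaarMeasure

omit [DiscreteTopology Γ] [IsZLattice ℝ Γ] in
lemma lattice_vaddInvariant : VAddInvariantMeasure Γ (Eucl m × ℝ) volume :=
  (inferInstance : VAddInvariantMeasure Γ.toAddSubgroup (Eucl m × ℝ) volume)

omit [DiscreteTopology Γ] [IsZLattice ℝ Γ] in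
lemma lattice_measurableVAdd : MeasurableVAdd Γ (Eucl m × ℝ) :=
  (inferInstance : MeasurableVAdd Γ.toAddSubgroup (Eucl m × ℝ))

attribute [local instance] lattice_vaddInvariant lattice_measurableVAdd

/-- A fundamental domain of the lattice `Γ`. -/
noncomputable def latticeDomain : Set (Eucl m × ℝ) :=
  ZSpan.fundamentalDomain ((Free.chooseBasis ℤ Γ).ofZLatticeBasis ℝ)

lemma isAddFundamentalDomain_latticeDomain :
    IsAddFundamentalDomain Γ (latticeDomain Γ) volume :=
  ZLattice.isAddFundamentalDomain _ _

/-- The covolume of `Γ`. -/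
noncomputable def latticeCovol : ℝ := volume.real (latticeDomain Γ)

lemma latticeCovol_pos : 0 < latticeCovol Γ := measureReal_fundamentalDomain_pos _ _

lemma ofReal_latticeCovol : ENNReal.ofReal (latticeCovol Γ) = volume (latticeDomain Γ) :=
  ENNReal.ofReal_toReal (measure_fundamentalDomain_ne_top _ _)

/-- Unfolding of the volume: up to the factor covol Γ, it is the mean of the number of points of Γ +
z in S over z in a fundamental domain. -/
lemma volume_eq_lintegral_tsum {S : Set (Eucl m × ℝ)} (hS : MeasurableSet S) :
    volume S = ∫⁻ z in latticeDomain Γ, ∑' γ : Γ, S.indicator (1 : Eucl m × ℝ → ℝ≥0∞) (γ +ᵥ z) := by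
  rw [lintegral_tsum, ← (isAddFundamentalDomain_latticeDomain Γ).lintegral_eq_tsum'',
    lintegral_indicator_one hS]
  intro γ
  exact ((measurable_one.indicator hS).comp (measurable_const_vadd γ)).aemeasurable

variable {Γ}

omit [DiscreteTopology Γ] [IsZLattice ℝ Γ] in
/-- Finitely many points of `Γ` have second coordinates which are `δ`-dense in `[-C, C]`. -/
lemma exists_finite_delta_dense (hΓ : Dense (Prod.snd '' (Γ : Set (Eucl m × ℝ)))) {δ : ℝ}
    (hδ : 0 < δ) (C : ℝ) :
    ∃ S : Finset Γ, ∀ s ∈ Set.Icc (-C) C, ∃ γ ∈ S, |(γ : Eucl m × ℝ).2 - s| ≤ δ := by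
  obtain ⟨t, ht⟩ := (isCompact_Icc (a := -C) (b := C)).elim_finite_subcover
    (fun γ : Γ => Metric.ball (γ : Eucl m × ℝ).2 δ) (fun _ => Metric.isOpen_ball) (by
      intro s _
      obtain ⟨y, ⟨γ, hγ, rfl⟩, hy⟩ := Metric.dense_iff.1 hΓ s δ hδ |>.imp fun _ h => h.symm
      exact Set.mem_iUnion.2 ⟨⟨γ, hγ⟩, by rw [Metric.mem_ball, dist_comm]; exact hy⟩)
  refine ⟨t, fun s hs => ?_⟩
  obtain ⟨γ, hγ, h⟩ := Set.mem_iUnion₂.1 (ht hs)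
  refine ⟨γ, hγ, ?_⟩
  rw [Metric.mem_ball, Real.dist_eq, abs_sub_comm] at h
  exact h.le

/-- Each z in the fundamental domain is replaced by a lattice point whose height is within δ of that
of z. By compactness finitely many lattice points suffice, so the horizontal error is at most a
constant C. It is not small, but independent of R, hence negligible as R → ∞; the vertical error δ
is arbitrary. -/
lemma exists_latticeCount_bounds (hΓ : Dense (Prod.snd '' (Γ : Set (Eucl m × ℝ)))) {δ : ℝ}
    (hδ : 0 < δ) : ∃ C : ℝ, 0 ≤ C ∧ ∀ (x : Eucl m) (R a : ℝ),
      ENNReal.ofReal (latticeCovol Γ) *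
        latticeCount Γ (cube x (R - 2 * C) ×ˢ Set.Icc (-(a - δ)) (a - δ)) ≤
          ENNReal.ofReal R ^ m * ENNReal.ofReal (2 * a) ∧
      ENNReal.ofReal R ^ m * ENNReal.ofReal (2 * a) ≤ ENNReal.ofReal (latticeCovol Γ) *
        latticeCount Γ (cube x (R + 2 * C) ×ˢ Set.Icc (-(a + δ)) (a + δ)) := by
  obtain ⟨C₁, hC₁⟩ := (ZSpan.fundamentalDomain_isBounded
    ((Free.chooseBasis ℤ Γ).ofZLatticeBasis ℝ)).exists_norm_le
  obtain ⟨S, hS⟩ := exists_finite_delta_dense hΓ hδ C₁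
  -- The sum serves only as a common bound for the norms of the finitely many points.
  set C₂ : ℝ := ∑ γ ∈ S, ‖(γ : Eucl m × ℝ)‖ with hC₂
  have hC₂0 : 0 ≤ C₂ := Finset.sum_nonneg fun _ _ => norm_nonneg _
  have hshift : ∀ z ∈ latticeDomain Γ, ∃ γ₀ : Γ, |(γ₀ : Eucl m × ℝ).2 - z.2| ≤ δ ∧
      ∀ i, |(γ₀ : Eucl m × ℝ).1 i - z.1 i| ≤ |C₁| + C₂ := by
    intro z hz
    have h1 : ‖z‖ ≤ C₁ := hC₁ z hz
    have h2 : |z.2| ≤ C₁ := (norm_snd_le z).trans h1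
    obtain ⟨γ₀, hγ₀, h3⟩ := hS z.2 (abs_le.1 h2)
    refine ⟨γ₀, h3, fun i => ?_⟩
    have h4 : |(γ₀ : Eucl m × ℝ).1 i| ≤ C₂ :=
      ((PiLp.norm_apply_le (γ₀ : Eucl m × ℝ).1 i).trans (norm_fst_le _)).trans
        (Finset.single_le_sum (f := fun γ : Γ => ‖(γ : Eucl m × ℝ)‖)
          (fun _ _ => norm_nonneg _) hγ₀)
    have h5 : |z.1 i| ≤ |C₁| :=
      ((PiLp.norm_apply_le z.1 i).trans (norm_fst_le _)).trans (h1.trans (le_abs_self _))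
    linarith [abs_sub (z.1 i) ((γ₀ : Eucl m × ℝ).1 i), abs_sub ((γ₀ : Eucl m × ℝ).1 i) (z.1 i)]
  set C := |C₁| + C₂ with hC
  have hC0 : 0 ≤ C := by positivity
  have hvol : ∀ (x : Eucl m) (R a : ℝ), volume (cube x R ×ˢ Set.Icc (-a) a)
      = ENNReal.ofReal R ^ m * ENNReal.ofReal (2 * a) := by
    intro x R a
    rw [Measure.volume_eq_prod, Measure.prod_prod, volume_cube, Real.volume_Icc]
    congr 2; ring
  have hmeas : ∀ (x : Eucl m) (R a : ℝ), MeasurableSet (cube x R ×ˢ Set.Icc (-a) a) :=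
    fun x R a => (measurableSet_cube x R).prod measurableSet_Icc
  have hDm : MeasurableSet (latticeDomain Γ) := ZSpan.fundamentalDomain_measurableSet _
  -- Cubes are anchored at a corner: a margin C on all sides moves the corner by C in each
  -- coordinate and changes the side by 2C.
  let c : Eucl m := WithLp.toLp 2 fun _ => C
  refine ⟨C, hC0, fun x R a => ⟨?_, ?_⟩⟩
  · rw [← hvol (x - c) R a, volume_eq_lintegral_tsum Γ (hmeas _ R a), ofReal_latticeCovol,
      mul_comm, ← setLIntegral_const]
    refine setLIntegral_mono' hDm fun z hz => ?_
    obtain ⟨γ₀, h2, h1⟩ := hshift z hz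
    refine latticeCount_ge_of_shift Γ z γ₀ fun γ hγ => ⟨fun i => ?_, ?_⟩
    · have h := hγ.1 i
      have h' := abs_le.1 (h1 i)
      simp only [Prod.fst_add, PiLp.add_apply, PiLp.sub_apply, c] at h ⊢
      constructor <;> linarith
    · have h := hγ.2
      have h' := abs_le.1 h2
      simp only [Prod.snd_add, Set.mem_Icc] at h ⊢
      constructor <;> linarith
  · rw [← hvol (x + c) R a, volume_eq_lintegral_tsum Γ (hmeas _ R a), ofReal_latticeCovol,
      mul_comm, ← setLIntegral_const]
    refine setLIntegral_mono' hDm fun z hz => ?_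
    obtain ⟨γ₀, h2, h1⟩ := hshift z hz
    refine latticeCount_le_of_shift Γ z γ₀ fun γ hγ => ⟨fun i => ?_, ?_⟩
    · have h := hγ.1 i
      have h' := abs_le.1 (h1 i)
      simp only [Prod.fst_add, PiLp.add_apply, c] at h ⊢
      constructor <;> linarith
    · have h := hγ.2
      have h' := abs_le.1 h2
      simp only [Prod.snd_add, Set.mem_Icc] at h ⊢
      constructor <;> linarith

omit [DiscreteTopology Γ] [IsZLattice ℝ Γ] in
lemma modelSet_inter_eq_image (x : Eucl m) (R : ℝ) (Ω : Set ℝ) :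
    modelSet Γ Ω ∩ cube x R = Prod.fst '' ((cube x R ×ˢ Ω) ∩ (Γ : Set (Eucl m × ℝ))) := by
  ext y
  constructor
  · rintro ⟨⟨γ, hγ, h2, rfl⟩, h1⟩
    exact ⟨γ, ⟨⟨h1, h2⟩, hγ⟩, rfl⟩
  · rintro ⟨γ, ⟨⟨h1, h2⟩, hγ⟩, rfl⟩
    exact ⟨⟨γ, hγ, h2, rfl⟩, h1⟩

lemma finite_modelSet_inter (x : Eucl m) (R : ℝ) {Ω : Set ℝ} (hΩ : Bornology.IsBounded Ω) :
    (modelSet Γ Ω ∩ cube x R).Finite := by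
  rw [modelSet_inter_eq_image]
  exact (finite_lattice_inter Γ ((isBounded_cube x R).prod hΩ)).image _

lemma latticeCount_eq_ncard (hΓ : Set.InjOn Prod.fst (Γ : Set (Eucl m × ℝ))) (x : Eucl m) (R : ℝ)
    {Ω : Set ℝ} (hΩ : Bornology.IsBounded Ω) :
    latticeCount Γ (cube x R ×ˢ Ω) = ENNReal.ofReal ((modelSet Γ Ω ∩ cube x R).ncard : ℝ) := by
  have hfin := finite_lattice_inter Γ ((isBounded_cube x R).prod hΩ)
  rw [modelSet_inter_eq_image, Set.InjOn.ncard_image (hΓ.mono Set.inter_subset_right),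
    ENNReal.ofReal_natCast, latticeCount]
  have h1 : ∑' γ : Γ, (cube x R ×ˢ Ω).indicator (1 : Eucl m × ℝ → ℝ≥0∞) (γ : Eucl m × ℝ)
      = ∑' γ : Eucl m × ℝ, ((cube x R ×ˢ Ω) ∩ (Γ : Set (Eucl m × ℝ))).indicator 1 γ := by
    rw [Set.inter_comm, ← Set.indicator_indicator]
    exact tsum_subtype (Γ : Set (Eucl m × ℝ)) ((cube x R ×ˢ Ω).indicator (1 : Eucl m × ℝ → ℝ≥0∞))
  rw [h1, ← tsum_subtype]
  have h2 := ENNReal.tsum_set_one ((cube x R ×ˢ Ω) ∩ (Γ : Set (Eucl m × ℝ)))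
  simp only [Pi.one_apply]
  rw [h2, ← hfin.cast_ncard_eq]
  rfl

/-- The density of a model set with an interval window. -/
theorem hasDensity_modelSet (hΓ : IsCutAndProject Γ) {a : ℝ} (ha : 0 < a) :
    HasDensity (modelSet Γ (Set.Icc (-a) a)) (2 * a / latticeCovol Γ) := by
  have hc := latticeCovol_pos Γ
  refine ⟨fun x R => finite_modelSet_inter x R (Metric.isBounded_Icc _ _), fun x => ?_⟩
  have hlim : ∀ C : ℝ, Tendsto (fun R : ℝ => ((R + C) / R) ^ m) atTop (𝓝 1) := by
    intro C
    have h : Tendsto (fun R : ℝ => 1 + C / R) atTop (𝓝 (1 + 0)) :=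
      (tendsto_const_nhds.div_atTop tendsto_id).const_add 1
    have h' := h.pow m
    rw [add_zero, one_pow] at h'
    refine h'.congr' ?_
    filter_upwards [eventually_ne_atTop 0] with R hR
    rw [add_div, div_self hR]
  refine tendsto_order.2 ⟨fun d hd => ?_, fun d hd => ?_⟩
  · have hlt : d * latticeCovol Γ / 2 < a := by
      rw [lt_div_iff₀ hc] at hd; linarith
    -- A half-length e < a with 2e / covol still above d; with δ = a - e the enlarged window is
    -- exactly [-a, a].
    obtain ⟨e, he1, he2⟩ := exists_between (max_lt hlt ha)
    obtain ⟨he1, he0⟩ := max_lt_iff.1 he1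
    obtain ⟨C, hC0, hC⟩ := exists_latticeCount_bounds hΓ.dense_snd (δ := a - e) (by linarith)
    have hlim' := ((hlim (-(2 * C))).mul_const (2 * e / latticeCovol Γ))
    rw [one_mul] at hlim'
    have hd' : d < 2 * e / latticeCovol Γ := by rw [lt_div_iff₀ hc]; linarith
    filter_upwards [hlim'.eventually_const_lt hd', eventually_gt_atTop 0,
      eventually_ge_atTop (2 * C)] with R hR hR0 hR2
    refine hR.trans_le ?_
    have h := (hC x (R - 2 * C) e).2
    rw [sub_add_cancel, add_sub_cancel, latticeCount_eq_ncard hΓ.injOn_fst x R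
      (Metric.isBounded_Icc _ _), ← ENNReal.ofReal_pow (by linarith), ← ENNReal.ofReal_mul hc.le,
      ← ENNReal.ofReal_mul (pow_nonneg (by linarith) _),
      ENNReal.ofReal_le_ofReal_iff (by positivity)] at h
    rw [div_pow, div_mul_div_comm, div_le_div_iff₀ (by positivity) (by positivity)]
    have hRm : 0 < R ^ m := by positivity
    rw [sub_eq_add_neg] at h
    nlinarith [mul_le_mul_of_nonneg_right h hRm.le]
  · have hlt : a < d * latticeCovol Γ / 2 := by
      rw [gt_iff_lt, div_lt_iff₀ hc] at hd; linarith
    -- Now e > a, and the window shrunk by δ = e - a is [-a, a].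
    obtain ⟨e, he1, he2⟩ := exists_between hlt
    obtain ⟨C, hC0, hC⟩ := exists_latticeCount_bounds hΓ.dense_snd (δ := e - a) (by linarith)
    have hlim' := ((hlim (2 * C)).mul_const (2 * e / latticeCovol Γ))
    rw [one_mul] at hlim'
    have hd' : 2 * e / latticeCovol Γ < d := by rw [div_lt_iff₀ hc]; linarith
    filter_upwards [hlim'.eventually_lt_const hd', eventually_gt_atTop 0] with R hR hR0
    refine lt_of_le_of_lt ?_ hR
    have h := (hC x (R + 2 * C) e).1
    rw [add_sub_cancel_right, sub_sub_cancel, latticeCount_eq_ncard hΓ.injOn_fst x R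
      (Metric.isBounded_Icc _ _), ← ENNReal.ofReal_pow (by linarith), ← ENNReal.ofReal_mul hc.le,
      ← ENNReal.ofReal_mul (pow_nonneg (by linarith) _),
      ENNReal.ofReal_le_ofReal_iff (mul_nonneg (pow_nonneg (by linarith) _) (by linarith))] at h
    rw [div_pow, div_mul_div_comm, div_le_div_iff₀ (by positivity) (by positivity)]
    have hRm : 0 < R ^ m := by positivity
    nlinarith [mul_le_mul_of_nonneg_right h hRm.le]

end Density
-- The mixed frame operator of two Bessel sequences
section FrameOperator

variable {m : ℕ} {ι : Type*}

/-- The analysis operator of a Bessel sequence. -/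
lemma IsBessel.exists_analysis {e : ι → L2 m} (he : IsBessel e) :
    ∃ C : L2 m →L[ℂ] lp (fun _ : ι => ℂ) 2, ∀ f i, C f i = inner ℂ (e i) f := by
  obtain ⟨B, hB, h⟩ := he
  have hmem : ∀ f : L2 m, Memℓp (fun i => inner ℂ (e i) f : ι → ℂ) 2 := fun f => by
    refine memℓp_gen ?_
    simpa using (h f).1
  let C₀ : L2 m →ₗ[ℂ] lp (fun _ : ι => ℂ) 2 :=
    { toFun := fun f => ⟨fun i => inner ℂ (e i) f, hmem f⟩
      map_add' := fun f g => by
        ext i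
        exact inner_add_right _ _ _
      map_smul' := fun c f => by
        ext i
        exact inner_smul_right _ _ _ }
  refine ⟨C₀.mkContinuous (Real.sqrt B) fun f => ?_, fun f i => rfl⟩
  have h1 : ‖C₀ f‖ ^ 2 = ∑' i, ‖inner ℂ (e i) f‖ ^ 2 := by
    have := lp.norm_rpow_eq_tsum (p := 2) (by simp) (C₀ f)
    rw [ENNReal.toReal_ofNat] at this
    exact_mod_cast this
  refine le_of_sq_le_sq ?_ (by positivity)
  rw [h1, mul_pow, Real.sq_sqrt hB.le]
  exact (h f).2

/-- The mixed frame operator `f ↦ ∑ᵢ ⟨f, eᵢ⟩ dᵢ` of two Bessel sequences. -/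
theorem IsBessel.exists_frameOperator {e d : ι → L2 m} (he : IsBessel e) (hd : IsBessel d) :
    ∃ T : L2 m →L[ℂ] L2 m, ∀ f, HasSum (fun i => inner ℂ (e i) f • d i) (T f) := by
  classical
  obtain ⟨Ce, hCe⟩ := he.exists_analysis
  obtain ⟨Cd, hCd⟩ := hd.exists_analysis
  refine ⟨(ContinuousLinearMap.adjoint Cd).comp Ce, fun f => ?_⟩
  -- The coefficient sequence is expanded in unit vectors of ℓ², and the adjoint of the analysis
  -- operator of d maps the i-th unit vector to d i.
  have h := (ContinuousLinearMap.adjoint Cd).hasSum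
    (lp.hasSum_single (E := fun _ : ι => ℂ) (p := 2) (by simp) (Ce f))
  have key : ∀ i (c : ℂ), (ContinuousLinearMap.adjoint Cd) (lp.single 2 i c) = c • d i := by
    intro i c
    refine ext_inner_left ℂ fun v => ?_
    rw [ContinuousLinearMap.adjoint_inner_right, lp.inner_single_right, hCd, inner_smul_right]
    simp
  simp only [key, hCe] at h
  exact h

/-- Duality means T = id, and a bounded operator is determined by its matrix coefficients on a set
with trivial orthogonal complement. -/
lemma isDualSystem_iff {e d : ι → L2 m} {T : L2 m →L[ℂ] L2 m}
    (hT : ∀ f, HasSum (fun i => inner ℂ (e i) f • d i) (T f)) {S : Set (L2 m)}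
    (hS : ∀ f, (∀ g ∈ S, inner ℂ g f = 0) → f = 0) :
    IsDualSystem d e ↔ ∀ f ∈ S, ∀ f' ∈ S, inner ℂ f' (T f) = inner ℂ f' f := by
  constructor
  · intro h f _ f' _
    rw [(hT f).unique (h f)]
  · intro h
    have h1 : ∀ f ∈ S, T f = f := fun f hf => by
      refine sub_eq_zero.1 (hS _ fun g hg => ?_)
      rw [inner_sub_right, h f hf g hg, sub_self]
    have h2 : Dense (Submodule.span ℂ S : Set (L2 m)) := by
      rw [Submodule.dense_iff_topologicalClosure_eq_top, Submodule.topologicalClosure_eq_top_iff,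
        Submodule.eq_bot_iff]
      intro f hf
      exact hS f fun g hg => (Submodule.mem_orthogonal _ f).1 hf g (Submodule.subset_span hg)
    have h3 : T = ContinuousLinearMap.id ℂ (L2 m) := by
      refine ContinuousLinearMap.ext_on h2 fun f hf => ?_
      simpa using h1 f hf
    intro f
    have := hT f
    rwa [h3] at this

lemma hasSum_inner_frameOperator {e d : ι → L2 m} {T : L2 m →L[ℂ] L2 m}
    (hT : ∀ f, HasSum (fun i => inner ℂ (e i) f • d i) (T f)) (f f' : L2 m) :
    HasSum (fun i => inner ℂ (e i) f * inner ℂ f' (d i)) (inner ℂ f' (T f)) := by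
  have h := (innerSL ℂ f').hasSum (hT f)
  simp only [map_smul, innerSL_apply_apply, smul_eq_mul] at h
  exact h

end FrameOperator
-- Γ-periodic functions and their restriction to the slice ℝ^m × {0}
section LatticePeriodic

open Module ComplexConjugate

variable {m : ℕ} {Γ : Submodule ℤ (Eucl m × ℝ)}

/-! ### The dual lattice and Fourier series of `Γ`-periodic functions -/

section Dual

variable [DiscreteTopology Γ] [IsZLattice ℝ Γ]

/-- A real basis of `ℝ^m × ℝ` which is a `ℤ`-basis of `Γ`. -/
noncomputable def latticeBasis (Γ : Submodule ℤ (Eucl m × ℝ)) [DiscreteTopology Γ]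
    [IsZLattice ℝ Γ] : Basis (Free.ChooseBasisIndex ℤ Γ) ℝ (Eucl m × ℝ) :=
  (Free.chooseBasis ℤ Γ).ofZLatticeBasis ℝ

/-- The integers are the values of η on the basis vectors of Γ; together with the next lemma this
identifies the characters of the torus with those of the dual lattice. -/
lemma exists_coords_of_mem_dualLattice {η : Eucl m × ℝ} (hη : η ∈ dualLattice Γ) :
    ∃ n : Free.ChooseBasisIndex ℤ Γ → ℤ,
      (∀ z : Eucl m × ℝ, ∑ i, n i * (latticeBasis Γ).repr z i
        = inner ℝ η.1 z.1 + η.2 * z.2) ∧ (n = 0 ↔ η = 0) := by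
  have hmem : ∀ i, latticeBasis Γ i ∈ Γ := fun i => by
    rw [latticeBasis, Basis.ofZLatticeBasis_apply]; exact Subtype.mem _
  choose n hn using fun i => hη (latticeBasis Γ i) (hmem i)
  have key : ∀ z : Eucl m × ℝ, ∑ i, n i * (latticeBasis Γ).repr z i
      = inner ℝ η.1 z.1 + η.2 * z.2 := by
    let φ₂ : Eucl m × ℝ →ₗ[ℝ] ℝ :=
      { toFun := fun z => inner ℝ η.1 z.1 + η.2 * z.2
        map_add' := fun z w => by simp [inner_add_right]; ring
        map_smul' := fun c z => by simp [real_inner_smul_right]; ring }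
    intro z
    have h1 : φ₂ z = ∑ i, (latticeBasis Γ).repr z i • φ₂ (latticeBasis Γ i) := by
      conv_lhs => rw [← (latticeBasis Γ).sum_repr z]
      simp only [map_sum, map_smul]
    change _ = φ₂ z
    rw [h1]
    refine Finset.sum_congr rfl fun i _ => ?_
    change _ = _ * (inner ℝ η.1 (latticeBasis Γ i).1 + η.2 * (latticeBasis Γ i).2)
    rw [real_inner_comm, mul_comm η.2, hn i, mul_comm]
  refine ⟨n, key, fun h => ?_, fun h => ?_⟩
  -- At z = η the identity reads 0 = |η|².
  · have h1 := key η
    simp only [h, Pi.zero_apply, Int.cast_zero, zero_mul, Finset.sum_const_zero,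
      real_inner_self_eq_norm_sq] at h1
    have h2 : ‖η.1‖ = 0 := by nlinarith [norm_nonneg η.1, mul_self_nonneg η.2, sq_nonneg ‖η.1‖]
    have h3 : η.2 = 0 := by nlinarith [norm_nonneg η.1, mul_self_nonneg η.2, sq_nonneg ‖η.1‖]
    exact Prod.ext (norm_eq_zero.1 h2) h3
  · funext i
    have h1 := hn i
    rw [h] at h1
    simp only [Prod.fst_zero, inner_zero_right, Prod.snd_zero, mul_zero, add_zero] at h1
    exact_mod_cast h1.symm

/-- The functional with integer coefficients n is represented by the Riesz vector of its restriction
to ℝ^m and its value at (0, 1); it is integral on Γ because points of Γ have integer coordinates. -/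
lemma exists_mem_dualLattice_of_coords (n : Free.ChooseBasisIndex ℤ Γ → ℤ) :
    ∃ η ∈ dualLattice Γ, (∀ z : Eucl m × ℝ, ∑ i, n i * (latticeBasis Γ).repr z i
        = inner ℝ η.1 z.1 + η.2 * z.2) ∧ (n = 0 ↔ η = 0) := by
  let φ : Eucl m × ℝ →ₗ[ℝ] ℝ :=
    { toFun := fun z => ∑ i, n i * (latticeBasis Γ).repr z i
      map_add' := fun z w => by simp [mul_add, Finset.sum_add_distrib]
      map_smul' := fun c z => by
        simp only [map_smul, Finsupp.smul_apply, smul_eq_mul, RingHom.id_apply, Finset.mul_sum]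
        exact Finset.sum_congr rfl fun i _ => by ring }
  let η : Eucl m × ℝ := ((InnerProductSpace.toDual ℝ (Eucl m)).symm
    (LinearMap.toContinuousLinearMap (φ.comp (LinearMap.inl ℝ (Eucl m) ℝ))), φ (0, 1))
  have key : ∀ z : Eucl m × ℝ, ∑ i, n i * (latticeBasis Γ).repr z i
        = inner ℝ η.1 z.1 + η.2 * z.2 := by
    intro z
    change φ z = _
    have hz : z = (z.1, 0) + z.2 • (0, 1) := by ext <;> simp
    have h1 : inner ℝ η.1 z.1 = φ (z.1, 0) := by
      simp only [η, InnerProductSpace.toDual_symm_apply]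
      rfl
    conv_lhs => rw [hz]
    rw [map_add, map_smul, h1, smul_eq_mul, mul_comm]
  have hmem : η ∈ dualLattice Γ := by
    intro γ hγ
    have h := key γ
    have hr : ∀ i, (latticeBasis Γ).repr γ i = (Free.chooseBasis ℤ Γ).repr ⟨γ, hγ⟩ i :=
      fun i => Basis.ofZLatticeBasis_repr_apply ℝ Γ (Free.chooseBasis ℤ Γ) ⟨γ, hγ⟩ i
    refine ⟨∑ i, n i * (Free.chooseBasis ℤ Γ).repr ⟨γ, hγ⟩ i, ?_⟩
    rw [real_inner_comm, mul_comm γ.2, ← h]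
    push_cast
    simp only [hr]
  refine ⟨η, hmem, key, fun h => ?_, fun h => ?_⟩
  · have h1 := key η
    simp only [h, Pi.zero_apply, Int.cast_zero, zero_mul, Finset.sum_const_zero,
      real_inner_self_eq_norm_sq] at h1
    have h2 : ‖η.1‖ = 0 := by nlinarith [norm_nonneg η.1, mul_self_nonneg η.2, sq_nonneg ‖η.1‖]
    have h3 : η.2 = 0 := by nlinarith [norm_nonneg η.1, mul_self_nonneg η.2, sq_nonneg ‖η.1‖]
    exact Prod.ext (norm_eq_zero.1 h2) h3
  · funext i
    have h1 := key (latticeBasis Γ i)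
    rw [h] at h1
    simp only [Prod.fst_zero, inner_zero_left, Prod.snd_zero, zero_mul, add_zero] at h1
    rw [Finset.sum_eq_single i] at h1
    · simpa using h1
    · intro j _ hj
      simp [Basis.repr_self, hj.symm]
    · simp

end Dual

/-- The character `z ↦ exp(2πi η·z)` of `ℝ^m × ℝ`. -/
noncomputable def prodChar (η z : Eucl m × ℝ) : ℂ :=
  Complex.exp (2 * Real.pi * Complex.I * ((inner ℝ η.1 z.1 + η.2 * z.2 : ℝ) : ℂ))

lemma prodChar_eq_mul (η z : Eucl m × ℝ) : prodChar η z = character η.1 z.1 *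
    Complex.exp (2 * Real.pi * Complex.I * ((η.2 * z.2 : ℝ) : ℂ)) := by
  rw [prodChar, character, ← Complex.exp_add]
  congr 1
  push_cast
  ring

lemma prodChar_add_of_mem {η : Eucl m × ℝ} (hη : η ∈ dualLattice Γ) (γ : Γ) (z : Eucl m × ℝ) :
    prodChar η (γ + z) = prodChar η z := by
  obtain ⟨k, hk⟩ := hη γ γ.2
  rw [prodChar, prodChar, ← Complex.exp_periodic.int_mul k
    (2 * Real.pi * Complex.I * ((inner ℝ η.1 z.1 + η.2 * z.2 : ℝ) : ℂ))]
  congr 1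
  have : inner ℝ η.1 ((γ : Eucl m × ℝ) + z).1 + η.2 * ((γ : Eucl m × ℝ) + z).2
      = (inner ℝ η.1 z.1 + η.2 * z.2) + k := by
    rw [← hk, Prod.fst_add, Prod.snd_add, inner_add_right, real_inner_comm]
    ring
  rw [this]
  push_cast
  ring

lemma norm_prodChar (η z : Eucl m × ℝ) : ‖prodChar η z‖ = 1 := by
  have h : 2 * Real.pi * Complex.I * ((inner ℝ η.1 z.1 + η.2 * z.2 : ℝ) : ℂ)
      = ((2 * Real.pi * (inner ℝ η.1 z.1 + η.2 * z.2) : ℝ) : ℂ) * Complex.I := by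
    push_cast; ring
  rw [prodChar, h, Complex.norm_exp_ofReal_mul_I]

lemma continuous_prodChar (η : Eucl m × ℝ) : Continuous (prodChar η) := by
  unfold prodChar
  fun_prop

section Fourier

variable [DiscreteTopology Γ] [IsZLattice ℝ Γ]

lemma integral_prodChar {η : Eucl m × ℝ} (hη : η ∈ dualLattice Γ) :
    ∫ z in latticeDomain Γ, conj (prodChar η z) =
      if η = 0 then (latticeCovol Γ : ℂ) else 0 := by
  obtain ⟨n, hn, h0⟩ := exists_coords_of_mem_dualLattice hη
  have h := integral_basisChar (latticeBasis Γ) volume n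
  simp only [basisChar, hn, h0] at h
  exact h

/-- Uniqueness of Fourier coefficients, applied to F - c. -/
lemma ae_eq_const_of_fourier {F : Eucl m × ℝ → ℂ}
    (hF : MemLp F 2 (volume.restrict (latticeDomain Γ))) (c : ℂ)
    (h : ∀ η ∈ dualLattice Γ, ∫ z in latticeDomain Γ, F z * conj (prodChar η z) =
      if η = 0 then c * latticeCovol Γ else 0) :
    ∀ᵐ z ∂volume.restrict (latticeDomain Γ), F z = c := by
  have hfin : volume (latticeDomain Γ) ≠ ∞ := measure_fundamentalDomain_ne_top _ _
  have : IsFiniteMeasure (volume.restrict (latticeDomain Γ)) := ⟨by simpa using hfin.lt_top⟩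
  have hFc : MemLp (fun z => F z - c) 2 (volume.restrict (latticeDomain Γ)) :=
    hF.sub (memLp_const c)
  have hchar : ∀ η : Eucl m × ℝ, AEStronglyMeasurable (fun z => conj (prodChar η z))
      (volume.restrict (latticeDomain Γ)) := fun η =>
    (Complex.continuous_conj.comp (continuous_prodChar η)).aestronglyMeasurable
  have hzero := ae_eq_zero_of_fourier_eq_zero (latticeBasis Γ) volume hFc (fun n => by
    obtain ⟨η, hη, hn, -⟩ := exists_mem_dualLattice_of_coords (Γ := Γ) n
    have e : ∀ z, basisChar (latticeBasis Γ) n z = prodChar η z := fun z => by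
      rw [basisChar, hn]; rfl
    simp only [e, sub_mul]
    have i1 : Integrable (fun z => F z * conj (prodChar η z))
        (volume.restrict (latticeDomain Γ)) := by
      refine (hF.integrable one_le_two).mul_bdd (c := 1) (hchar η) (Eventually.of_forall fun z => ?_)
      rw [RCLike.norm_conj, norm_prodChar]
    have i2 : Integrable (fun z => c * conj (prodChar η z))
        (volume.restrict (latticeDomain Γ)) := by
      refine (integrable_const c).mul_bdd (c := 1) (hchar η) (Eventually.of_forall fun z => ?_)
      rw [RCLike.norm_conj, norm_prodChar]
    change ∫ z in latticeDomain Γ, _ = 0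
    rw [integral_sub i1 i2, h η hη, integral_const_mul, integral_prodChar hη]
    split_ifs <;> simp)
  filter_upwards [hzero] with z hz
  exact sub_eq_zero.1 hz

end Fourier

/-! ### Periodization along a model set -/

/-- The function `(x, s) ↦ 1_{[-a, a]}(s) K(x)`. -/
noncomputable def windowed (a : ℝ) (K : Eucl m → ℂ) (z : Eucl m × ℝ) : ℂ :=
  if |z.2| ≤ a then K z.1 else 0

/-- The `Γ`-periodization of `windowed a K`. -/
noncomputable def periodized (Γ : Submodule ℤ (Eucl m × ℝ)) (a : ℝ) (K : Eucl m → ℂ)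
    (z : Eucl m × ℝ) : ℂ :=
  ∑' γ : Γ, windowed a K (γ + z)

lemma windowed_eq_mul (a : ℝ) (K : Eucl m → ℂ) (z : Eucl m × ℝ) :
    windowed a K z = K z.1 * (Set.Icc (-a) a).indicator 1 z.2 := by
  by_cases h : |z.2| ≤ a
  · rw [windowed, if_pos h, Set.indicator_of_mem (Set.mem_Icc.2 (abs_le.1 h))]; simp
  · rw [windowed, if_neg h, Set.indicator_of_notMem (fun h' => h (abs_le.2 (Set.mem_Icc.1 h')))]; simp

lemma integrable_windowed {a : ℝ} {K : Eucl m → ℂ} (hK : Integrable K) :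
    Integrable (windowed a K) := by
  have h1 : Integrable ((Set.Icc (-a) a).indicator (1 : ℝ → ℂ)) :=
    (integrable_indicator_iff measurableSet_Icc).2 (integrableOn_const (by simp))
  exact (hK.mul_prod h1).congr (Eventually.of_forall fun z => (windowed_eq_mul a K z).symm)

/-- The Fourier transform of `windowed a K`. -/
lemma integral_windowed_mul {a : ℝ} (ha : 0 < a) (K : Eucl m → ℂ) (η : Eucl m × ℝ) :
    ∫ z, windowed a K z * conj (prodChar η z) =
      ((2 * a * Real.sinc (Real.pi * (η.2 * (2 * a))) : ℝ) : ℂ) *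
        ∫ x, K x * conj (character η.1 x) := by
  have h1 : ∀ z : Eucl m × ℝ, windowed a K z * conj (prodChar η z)
      = (K z.1 * conj (character η.1 z.1)) * ((Set.Icc (-a) a).indicator (fun s : ℝ =>
        Complex.exp (2 * Real.pi * Complex.I * ((-η.2 * s : ℝ) : ℂ))) z.2) := by
    intro z
    rw [windowed_eq_mul, prodChar_eq_mul, map_mul]
    by_cases h : z.2 ∈ Set.Icc (-a) a
    · rw [Set.indicator_of_mem h, Set.indicator_of_mem h, ← Complex.exp_conj]
      simp [map_ofNat, mul_assoc]
    · rw [Set.indicator_of_notMem h, Set.indicator_of_notMem h]; simp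
  simp only [h1]
  rw [Measure.volume_eq_prod, integral_prod_mul (fun x => K x * conj (character η.1 x)),
    mul_comm, integral_indicator measurableSet_Icc, integral_Icc_eq_integral_Ioc,
    ← intervalIntegral.integral_of_le (by linarith), intervalIntegral_exp_eq_sinc]
  congr 1
  have e : Real.pi * (-η.2 * (a - -a)) = -(Real.pi * (η.2 * (2 * a))) := by ring
  rw [e, Real.sinc_neg, add_comm (-a), ← sub_eq_add_neg, sub_self, mul_zero, Complex.ofReal_zero,
    mul_zero, Complex.exp_zero]
  push_cast
  ring

lemma periodized_vadd (a : ℝ) (K : Eucl m → ℂ) (γ : Γ) (z : Eucl m × ℝ) :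
    periodized Γ a K (γ + z) = periodized Γ a K z := by
  rw [periodized, periodized, ← (Equiv.addRight γ).tsum_eq (fun γ' : Γ => windowed a K (γ' + z))]
  refine tsum_congr fun γ' => ?_
  rw [Equiv.coe_addRight, Submodule.coe_add, add_assoc]

/-- Locally uniform boundedness of the sums of `|K|` along the model sets of `Γ`. -/
def HasModelSetBound (Γ : Submodule ℤ (Eucl m × ℝ)) (a : ℝ) (K : Eucl m → ℂ) (M : ℝ) : Prop :=
  ∀ (x : Eucl m) (s : ℝ) (S : Finset Γ), (∀ γ ∈ S, |(γ : Eucl m × ℝ).2 + s| ≤ 5 / 4 * a) →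
    ∑ γ ∈ S, ‖K ((γ : Eucl m × ℝ).1 + x)‖ ≤ M

variable {a : ℝ} {K : Eucl m → ℂ} {M : ℝ}

lemma HasModelSetBound.sum_le (hK : HasModelSetBound Γ a K M) (z : Eucl m × ℝ) (S : Finset Γ) :
    ∑ γ ∈ S, ‖windowed (5 / 4 * a) K (γ + z)‖ ≤ M := by
  classical
  have h := hK z.1 z.2 (S.filter fun γ => |(γ : Eucl m × ℝ).2 + z.2| ≤ 5 / 4 * a)
    (fun γ hγ => (Finset.mem_filter.1 hγ).2)
  rw [Finset.sum_filter] at h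
  refine le_trans (le_of_eq (Finset.sum_congr rfl fun γ _ => ?_)) h
  rw [windowed, Prod.snd_add, Prod.fst_add]
  split_ifs <;> simp

lemma HasModelSetBound.summable (hK : HasModelSetBound Γ a K M) (z : Eucl m × ℝ) :
    Summable fun γ : Γ => ‖windowed (5 / 4 * a) K (γ + z)‖ :=
  summable_of_sum_le (fun _ => norm_nonneg _) (hK.sum_le z)

/-- The margin a/4 between the windows of half-length a and 5a/4 yields one summable majorant for
all heights within a/4 of a given one. This is the role of 5/4 in `HasModelSetBound`. -/
lemma norm_windowed_le {z w : Eucl m × ℝ} (h1 : z.1 = w.1)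
    (h2 : |z.2 - w.2| ≤ a / 4) : ‖windowed a K z‖ ≤ ‖windowed (5 / 4 * a) K w‖ := by
  by_cases h : |z.2| ≤ a
  · have h3 : |w.2| ≤ 5 / 4 * a := by
      have := abs_sub_abs_le_abs_sub w.2 z.2
      rw [abs_sub_comm] at this
      linarith
    rw [windowed, windowed, if_pos h, if_pos h3, h1]
  · rw [windowed, if_neg h, norm_zero]; exact norm_nonneg _

lemma HasModelSetBound.summable_norm (ha : 0 < a) (hK : HasModelSetBound Γ a K M)
    (z : Eucl m × ℝ) : Summable fun γ : Γ => ‖windowed a K (γ + z)‖ :=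
  Summable.of_nonneg_of_le (fun _ => norm_nonneg _)
    (fun γ => norm_windowed_le rfl (by simp; positivity)) (hK.summable z)

lemma HasModelSetBound.norm_periodized_le (ha : 0 < a) (hK : HasModelSetBound Γ a K M)
    (z : Eucl m × ℝ) : ‖periodized Γ a K z‖ ≤ M :=
  (norm_tsum_le_tsum_norm (hK.summable_norm ha z)).trans <|
    ((hK.summable_norm ha z).tsum_le_tsum (fun γ => norm_windowed_le rfl (by simp; positivity))
      (hK.summable z)).trans ((hK.summable z).tsum_le_of_sum_le (hK.sum_le z))

/-- Dominated convergence: each term is locally constant in s as long as its lattice point is not on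
the boundary of the window. -/
lemma HasModelSetBound.continuousAt_periodized (ha : 0 < a) (hK : HasModelSetBound Γ a K M)
    (x : Eucl m) {s : ℝ} (hs : ∀ γ : Γ, |(γ : Eucl m × ℝ).2 + s| ≠ a) :
    ContinuousAt (fun s => periodized Γ a K (x, s)) s := by
  refine tendsto_tsum_of_dominated_convergence (hK.summable (x, s)) (fun γ => ?_) ?_
  · refine tendsto_const_nhds.congr' ?_
    have hc : ContinuousAt (fun s' : ℝ => |(γ : Eucl m × ℝ).2 + s'|) s := by fun_prop
    rcases lt_or_gt_of_ne (hs γ) with h | h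
    · filter_upwards [hc.eventually_lt continuousAt_const h] with s' hs'
      simp only [windowed, Prod.snd_add, Prod.fst_add]
      rw [if_pos h.le, if_pos hs'.le]
    · filter_upwards [continuousAt_const.eventually_lt hc h] with s' hs'
      simp only [windowed, Prod.snd_add, Prod.fst_add]
      rw [if_neg h.not_ge, if_neg hs'.not_ge]
  · filter_upwards [Metric.closedBall_mem_nhds s (by positivity : 0 < a / 4)] with s' hs' γ
    refine norm_windowed_le rfl ?_
    simpa [Real.dist_eq] using hs'

section

variable [DiscreteTopology Γ] [IsZLattice ℝ Γ]

attribute [local instance] lattice_vaddInvariant lattice_measurableVAdd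

lemma aestronglyMeasurable_periodized (ha : 0 < a) (hK : HasModelSetBound Γ a K M)
    (hKi : Integrable K) : AEStronglyMeasurable (periodized Γ a K) volume := by
  refine aestronglyMeasurable_of_tendsto_ae (u := (atTop : Filter (Finset Γ)))
    (f := fun S z => ∑ γ ∈ S, windowed a K (γ + z)) (fun S => ?_)
    (Eventually.of_forall fun z => (hK.summable_norm ha z).of_norm.hasSum)
  refine Finset.aestronglyMeasurable_fun_sum S fun γ _ => ?_
  exact (integrable_windowed hKi).1.comp_measurePreserving
    (measurePreserving_add_left volume (γ : Eucl m × ℝ))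

lemma memLp_periodized (ha : 0 < a) (hK : HasModelSetBound Γ a K M) (hKi : Integrable K) :
    MemLp (periodized Γ a K) 2 (volume.restrict (latticeDomain Γ)) := by
  have hfin : volume (latticeDomain Γ) ≠ ∞ := measure_fundamentalDomain_ne_top _ _
  have : IsFiniteMeasure (volume.restrict (latticeDomain Γ)) := ⟨by simpa using hfin.lt_top⟩
  exact MemLp.of_bound (aestronglyMeasurable_periodized ha hK hKi).restrict M
    (Eventually.of_forall fun z => hK.norm_periodized_le ha z)

/-- The character is Γ-invariant, so unfolding turns the coefficient into the Fourier transform of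
`windowed a K`, a product of two transforms. -/
lemma integral_periodized_mul (ha : 0 < a) (hKi : Integrable K) {η : Eucl m × ℝ}
    (hη : η ∈ dualLattice Γ) :
    ∫ z in latticeDomain Γ, periodized Γ a K z * conj (prodChar η z) =
      ((2 * a * Real.sinc (Real.pi * (η.2 * (2 * a))) : ℝ) : ℂ) *
        ∫ x, K x * conj (character η.1 x) := by
  rw [← integral_windowed_mul ha, integral_eq_setIntegral_tsum_vadd
    (isAddFundamentalDomain_latticeDomain Γ)]
  · refine integral_congr_ae (Eventually.of_forall fun z => ?_)
    have h : ∀ γ : Γ, windowed a K (γ +ᵥ z) * conj (prodChar η (γ +ᵥ z))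
        = windowed a K (γ + z) * conj (prodChar η z) := fun γ => by
      change windowed a K (γ + z) * conj (prodChar η (γ + z)) = _
      rw [prodChar_add_of_mem hη]
    simp only [h, periodized]
    rw [tsum_mul_right]
  · refine (integrable_windowed hKi).mul_bdd (c := 1)
      (Complex.continuous_conj.comp (continuous_prodChar η)).aestronglyMeasurable
      (Eventually.of_forall fun z => ?_)
    rw [RCLike.norm_conj, norm_prodChar]

/-- A sum over all translates of a model set is constant if and only if its Fourier–Bohr
coefficients are those of a constant. -/
theorem periodized_eq_const_iff (hΓ : IsCutAndProject Γ) (ha : 0 < a)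
    (hgen : ∀ γ : Γ, |(γ : Eucl m × ℝ).2| ≠ a) (hK : HasModelSetBound Γ a K M)
    (hKi : Integrable K) (hcont : Continuous fun x => periodized Γ a K (x, 0)) (c : ℂ) :
    (∀ x, periodized Γ a K (x, 0) = c) ↔ ∀ η ∈ dualLattice Γ,
      ((2 * a * Real.sinc (Real.pi * (η.2 * (2 * a))) : ℝ) : ℂ) *
        ∫ x, K x * conj (character η.1 x) = if η = 0 then c * latticeCovol Γ else 0 := by
  constructor
  · intro h η hη
    rw [← integral_periodized_mul ha hKi hη]
    -- By periodicity the slice at height p₂(γ) is a translate of the slice at height 0.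
    have hper : ∀ (γ : Γ) (x : Eucl m), periodized Γ a K (x, (γ : Eucl m × ℝ).2) = c := by
      intro γ x
      rw [← h (x - (γ : Eucl m × ℝ).1), ← periodized_vadd a K γ (x - (γ : Eucl m × ℝ).1, 0)]
      congr 1
      ext <;> simp
    -- These heights are dense, so the value c passes to every height at which the periodization is
    -- continuous in s.
    have hgood : ∀ (x : Eucl m) (s : ℝ), (∀ γ : Γ, |(γ : Eucl m × ℝ).2 + s| ≠ a) →
        periodized Γ a K (x, s) = c := by
      intro x s hs
      have h1 := (hK.continuousAt_periodized ha x hs).continuousWithinAt.mem_closure_image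
        (hΓ.dense_snd s)
      have h2 : (fun s => periodized Γ a K (x, s)) '' (Prod.snd '' (Γ : Set (Eucl m × ℝ))) ⊆ {c} := by
        rintro _ ⟨_, ⟨γ, hγ, rfl⟩, rfl⟩
        exact hper ⟨γ, hγ⟩ x
      simpa using closure_mono h2 h1
    -- Each of the countably many lattice points excludes at most two heights.
    have hcount : ({s : ℝ | ∃ γ : Γ, |(γ : Eucl m × ℝ).2 + s| = a}).Countable := by
      have : {s : ℝ | ∃ γ : Γ, |(γ : Eucl m × ℝ).2 + s| = a}
          = ⋃ γ : Γ, {s : ℝ | |(γ : Eucl m × ℝ).2 + s| = a} := by ext; simp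
      rw [this]
      refine Set.countable_iUnion fun γ => ?_
      refine (Set.toFinite {a - (γ : Eucl m × ℝ).2, -a - (γ : Eucl m × ℝ).2}).countable.mono ?_
      intro s hs
      rcases (abs_eq ha.le).1 hs with h | h
      · left; linarith
      · right; simp; linarith
    have hae : ∀ᵐ z : Eucl m × ℝ, periodized Γ a K z = c := by
      have h1 : ∀ᵐ z : Eucl m × ℝ, z.2 ∉ {s : ℝ | ∃ γ : Γ, |(γ : Eucl m × ℝ).2 + s| = a} :=
        (Measure.quasiMeasurePreserving_snd (μ := (volume : Measure (Eucl m)))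
          (ν := (volume : Measure ℝ))).ae (hcount.ae_notMem volume)
      filter_upwards [h1] with z hz
      exact hgood z.1 z.2 fun γ hγ => hz ⟨γ, hγ⟩
    rw [integral_congr_ae (g := fun z => c * conj (prodChar η z))
      ((ae_restrict_of_ae hae).mono fun z hz => by simp only [hz]), integral_const_mul,
      integral_prodChar hη]
    split_ifs <;> simp
  · intro h
    have h1 := ae_eq_const_of_fourier (memLp_periodized ha hK hKi) c fun η hη => by
      rw [integral_periodized_mul ha hKi hη]; exact h η hη
    -- The exceptional set is Γ-invariant and null in a fundamental domain, hence null.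
    have h2 : ∀ᵐ z : Eucl m × ℝ, periodized Γ a K z = c := by
      rw [ae_iff]
      refine (isAddFundamentalDomain_latticeDomain Γ).measure_zero_of_invariant _ (fun γ => ?_) ?_
      · ext z
        rw [Set.mem_vadd_set_iff_neg_vadd_mem]
        change ¬ periodized Γ a K ((-γ : Γ) + z) = c ↔ ¬ periodized Γ a K z = c
        rw [periodized_vadd]
      · have hm : MeasurableSet (latticeDomain Γ) := ZSpan.fundamentalDomain_measurableSet _
        rw [ae_restrict_iff' hm, ae_iff] at h1
        convert h1 using 2
        ext z
        simp [and_comm]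
    -- For almost every x the value c is taken at almost all heights, hence at a dense set of them;
    -- by genericity s = 0 is a point of continuity, so c is also taken there. Continuity in x
    -- removes the remaining null set.
    have h3 := Measure.ae_ae_of_ae_prod h2
    have h4 : (fun x => periodized Γ a K (x, 0)) =ᵐ[volume] fun _ => c := by
      filter_upwards [h3] with x hx
      have hd := Measure.dense_of_ae hx
      have h5 := (hK.continuousAt_periodized ha x (s := 0) (by simpa using hgen)).continuousWithinAt.mem_closure_image
        (hd 0)
      have h6 : (fun s => periodized Γ a K (x, s)) '' {s | periodized Γ a K (x, s) = c} ⊆ {c} := by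
        rintro _ ⟨s, hs, rfl⟩
        exact hs
      simpa using closure_mono h6 h5
    exact fun x => congrFun ((hcont.ae_eq_iff_eq volume continuous_const).1 h4) x

end

end LatticePeriodic
-- Time-frequency shifts, correlations and cell functions
section TimeFrequency

open Module ComplexConjugate

variable {m : ℕ}

/-! ### Translations and modulations on `L²` -/

lemma coeFn_translation (x : Eucl m) (f : L2 m) :
    translation x f =ᵐ[volume] fun t => f (t - x) :=
  Lp.coeFn_compMeasurePreserving f (measurePreserving_sub_right volume x)

lemma coeFn_modulation (ω : Eucl m) (f : L2 m) :
    modulation ω f =ᵐ[volume] fun t => character ω t * f t :=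
  (memLp_character_mul ω f).coeFn_toLp

lemma inner_translation_translation (x : Eucl m) (f g : L2 m) :
    inner ℂ (translation x f) (translation x g) = inner ℂ f g :=
  (Lp.compMeasurePreservingₗᵢ ℂ (fun t : Eucl m => t - x)
    (measurePreserving_sub_right volume x)).inner_map_map f g

lemma norm_translation (x : Eucl m) (f : L2 m) : ‖translation x f‖ = ‖f‖ :=
  Lp.norm_compMeasurePreserving f _

lemma translation_ae_eq {f : L2 m} {φ : Eucl m → ℂ} (hf : f =ᵐ[volume] φ) (x : Eucl m) :
    translation x f =ᵐ[volume] fun t => φ (t - x) :=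
  (coeFn_translation x f).trans
    ((measurePreserving_sub_right volume x).quasiMeasurePreserving.ae_eq_comp hf)

lemma translation_translation (x y : Eucl m) (f : L2 m) :
    translation x (translation y f) = translation (x + y) f := by
  refine Lp.ext ?_
  filter_upwards [translation_ae_eq (coeFn_translation y f) x, coeFn_translation (x + y) f]
    with t h1 h2
  rw [h1, h2, sub_sub]

lemma translation_zero (f : L2 m) : translation (0 : Eucl m) f = f := by
  refine Lp.ext ?_
  filter_upwards [coeFn_translation 0 f] with t h1
  rw [h1, sub_zero]

lemma continuous_translation (f : L2 m) : Continuous fun x : Eucl m => translation x f := by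
  let g : Eucl m → C(Eucl m, Eucl m) := fun x => ⟨fun t => t - x, by fun_prop⟩
  have hg : Continuous g := by
    refine ContinuousMap.continuous_of_continuous_uncurry _ ?_
    change Continuous fun p : Eucl m × Eucl m => p.2 - p.1
    fun_prop
  exact (continuous_const (y := f)).compMeasurePreservingLp hg
    (fun x => measurePreserving_sub_right volume x) (by simp)

lemma inner_translation_left (x : Eucl m) (f g : L2 m) :
    inner ℂ (translation x f) g = inner ℂ f (translation (-x) g) := by
  rw [← inner_translation_translation (-x), translation_translation, neg_add_cancel,
    translation_zero]

/-- The short-time Fourier transform as an integral. -/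
lemma inner_translation_modulation {f : L2 m} {φ : Eucl m → ℂ} (hf : f =ᵐ[volume] φ)
    (g : L2 m) (y ω : Eucl m) :
    inner ℂ (translation y (modulation ω g)) f
      = ∫ t, φ (t + y) * conj (g t) * conj (character ω t) := by
  rw [inner_translation_left, L2.inner_def]
  refine integral_congr_ae ?_
  filter_upwards [coeFn_modulation ω g, translation_ae_eq hf (-y)] with t h1 h2
  rw [h1, h2, RCLike.inner_apply, map_mul, sub_neg_eq_add]
  ring

/-! ### Correlations -/

/-- The correlation `y ↦ ∫ p(t + y) q(t) dt`. -/
noncomputable def correlation (p q : Eucl m → ℂ) (y : Eucl m) : ℂ := ∫ t, p (t + y) * q t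

lemma correlation_eq_convolution (p q : Eucl m → ℂ) :
    correlation p q = convolution (fun t => q (-t)) p (ContinuousLinearMap.mul ℂ ℂ) volume := by
  funext y
  rw [correlation, convolution, ← integral_neg_eq_self]
  refine integral_congr_ae (Eventually.of_forall fun t => ?_)
  simp only [ContinuousLinearMap.mul_apply']
  rw [mul_comm, neg_add_eq_sub]

lemma integrable_correlation {p q : Eucl m → ℂ} (hp : Integrable p) (hq : Integrable q) :
    Integrable (correlation p q) := by
  rw [correlation_eq_convolution]
  exact hq.comp_neg.integrable_convolution _ hp

lemma character_add_right (ω s t : Eucl m) :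
    character ω (s + t) = character ω s * character ω t := by
  rw [character, character, character, ← Complex.exp_add, inner_add_right]
  congr 1
  push_cast
  ring

lemma conj_character_mul_self (ω t : Eucl m) : conj (character ω t) * character ω t = 1 := by
  rw [mul_comm, Complex.mul_conj, Complex.normSq_eq_norm_sq, norm_character]
  simp

lemma integrable_mul_character {q : Eucl m → ℂ} (hq : Integrable q) (ω : Eucl m) :
    Integrable fun t => q t * character ω t :=
  hq.mul_bdd (c := 1) (continuous_character ω).aestronglyMeasurable
    (Eventually.of_forall fun t => (norm_character ω t).le)

lemma integrable_mul_conj_character {q : Eucl m → ℂ} (hq : Integrable q) (ω : Eucl m) :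
    Integrable fun t => q t * conj (character ω t) :=
  hq.mul_bdd (c := 1) (Complex.continuous_conj.comp (continuous_character ω)).aestronglyMeasurable
    (Eventually.of_forall fun t => by rw [RCLike.norm_conj, norm_character])

/-- The Fourier transform of a correlation. -/
lemma integral_correlation_mul {p q : Eucl m → ℂ} (hp : Integrable p) (hq : Integrable q)
    (ω : Eucl m) :
    ∫ y, correlation p q y * conj (character ω y) =
      (∫ u, p u * conj (character ω u)) * ∫ t, q t * character ω t := by
  have h1 : ∀ y, correlation p q y * conj (character ω y) =
      correlation (fun u => p u * conj (character ω u)) (fun t => q t * character ω t) y := by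
    intro y
    rw [correlation, correlation, ← integral_mul_const]
    refine integral_congr_ae (Eventually.of_forall fun t => ?_)
    simp only [character_add_right, map_mul]
    linear_combination (-(p (t + y) * q t * conj (character ω y))) * conj_character_mul_self ω t
  simp only [h1]
  rw [correlation_eq_convolution, integral_convolution _
    (integrable_mul_character hq ω).comp_neg (integrable_mul_conj_character hp ω),
    ContinuousLinearMap.mul_apply', mul_comm,
    integral_neg_eq_self (fun t => q t * character ω t)]

/-! ### Functions supported in a cell of a lattice -/

/-- The point with coordinates `w ∈ ℤ^m` in the basis `b`. -/
noncomputable def basisPoint (b : Basis (Fin m) ℝ (Eucl m)) (w : Fin m → ℤ) : Eucl m :=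
  ∑ i, (w i : ℝ) • b i

lemma repr_basisPoint (b : Basis (Fin m) ℝ (Eucl m)) (w : Fin m → ℤ) (i : Fin m) :
    b.repr (basisPoint b w) i = w i := by
  rw [basisPoint, b.repr_sum_self]

lemma basisPoint_sub (b : Basis (Fin m) ℝ (Eucl m)) (v w : Fin m → ℤ) :
    basisPoint b (v - w) = basisPoint b v - basisPoint b w := by
  simp [basisPoint, sub_smul]

lemma basisPoint_zero (b : Basis (Fin m) ℝ (Eucl m)) : basisPoint b 0 = 0 := by
  simp [basisPoint]

/-- The translate of the fundamental domain of `b` by the point with coordinates `w`. -/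
def cell (b : Basis (Fin m) ℝ (Eucl m)) (w : Fin m → ℤ) : Set (Eucl m) :=
  {t | t - basisPoint b w ∈ ZSpan.fundamentalDomain b}

lemma mem_cell_iff (b : Basis (Fin m) ℝ (Eucl m)) (w : Fin m → ℤ) (t : Eucl m) :
    t ∈ cell b w ↔ ∀ i, ⌊b.repr t i⌋ = w i := by
  simp only [cell, Set.mem_ofPred_eq, ZSpan.mem_fundamentalDomain, map_sub, Finsupp.sub_apply,
    repr_basisPoint, Int.floor_eq_iff, Set.mem_Ico]
  refine forall_congr' fun i => ⟨fun h => ⟨?_, ?_⟩, fun h => ⟨?_, ?_⟩⟩ <;> linarith [h.1, h.2]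

lemma measurableSet_cell (b : Basis (Fin m) ℝ (Eucl m)) (w : Fin m → ℤ) :
    MeasurableSet (cell b w) :=
  (ZSpan.fundamentalDomain_measurableSet b).preimage (measurable_id.sub_const _)

lemma volume_cell (b : Basis (Fin m) ℝ (Eucl m)) (w : Fin m → ℤ) :
    volume (cell b w) = volume (ZSpan.fundamentalDomain b) :=
  (measurePreserving_sub_right volume (basisPoint b w)).measure_preimage
    (ZSpan.fundamentalDomain_measurableSet b).nullMeasurableSet

lemma volume_cell_ne_top (b : Basis (Fin m) ℝ (Eucl m)) (w : Fin m → ℤ) :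
    volume (cell b w) ≠ ∞ := by
  rw [volume_cell]; exact measure_fundamentalDomain_ne_top b _

/-- `φ` is measurable, bounded by one and supported in the cell of `w`. -/
structure IsCellFunction (b : Basis (Fin m) ℝ (Eucl m)) (w : Fin m → ℤ) (φ : Eucl m → ℂ) :
    Prop where
  measurable : Measurable φ
  norm_le : ∀ t, ‖φ t‖ ≤ 1
  eq_zero : ∀ t ∉ cell b w, φ t = 0

variable {b : Basis (Fin m) ℝ (Eucl m)} {w w' : Fin m → ℤ} {φ φ' : Eucl m → ℂ}

lemma IsCellFunction.memLp (h : IsCellFunction b w φ) (p : ℝ≥0∞) : MemLp φ p volume := by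
  have h1 : MemLp ((cell b w).indicator fun _ => (1 : ℝ)) p (volume : Measure (Eucl m)) :=
    memLp_indicator_const p (measurableSet_cell b w) 1 (Or.inr (volume_cell_ne_top b w))
  refine h1.of_le h.measurable.aestronglyMeasurable (Eventually.of_forall fun t => ?_)
  by_cases ht : t ∈ cell b w
  · rw [Set.indicator_of_mem ht]; simpa using h.norm_le t
  · rw [h.eq_zero t ht, norm_zero]; exact norm_nonneg _

lemma IsCellFunction.indicator (b : Basis (Fin m) ℝ (Eucl m)) (w : Fin m → ℤ) {ψ : Eucl m → ℂ}
    (hm : Measurable ψ) (hψ : ∀ t, ‖ψ t‖ ≤ 1) : IsCellFunction b w ((cell b w).indicator ψ) where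
  measurable := hm.indicator (measurableSet_cell b w)
  norm_le t := (norm_indicator_le_norm_self _ _).trans (hψ t)
  eq_zero _ ht := Set.indicator_of_notMem ht _

/-- The classes of cell functions are total in `L²`. -/
lemma eq_zero_of_inner_cellFunction_eq_zero (b : Basis (Fin m) ℝ (Eucl m)) (f : L2 m)
    (h : ∀ g ∈ {g : L2 m | ∃ w φ, IsCellFunction b w φ ∧ g =ᵐ[volume] φ}, inner ℂ g f = 0) :
    f = 0 := by
  have hcell : ∀ w, ∀ᵐ t ∂volume.restrict (cell b w), f t = 0 := by
    intro w
    have : IsFiniteMeasure (volume.restrict (cell b w)) :=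
      ⟨by simpa using (volume_cell_ne_top b w).lt_top⟩
    have hint : Integrable f (volume.restrict (cell b w)) :=
      ((Lp.memLp f).restrict _).integrable one_le_two
    refine hint.ae_eq_zero_of_forall_setIntegral_eq_zero fun s hs _ => ?_
    rw [Measure.restrict_restrict hs]
    -- Pairing f with this test function gives the integral of f over s ∩ cell.
    have hφ : IsCellFunction b w ((cell b w).indicator (s.indicator 1)) :=
      IsCellFunction.indicator b w (measurable_one.indicator hs) fun t =>
        (norm_indicator_le_norm_self _ _).trans (by simp)
    have h1 := h _ ⟨w, _, hφ, (hφ.memLp 2).coeFn_toLp⟩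
    rw [L2.inner_def] at h1
    rw [← h1, ← integral_indicator (hs.inter (measurableSet_cell b w))]
    refine integral_congr_ae ?_
    filter_upwards [(hφ.memLp 2).coeFn_toLp] with t ht
    rw [ht, RCLike.inner_apply]
    by_cases h1 : t ∈ cell b w <;> by_cases h2 : t ∈ s <;> simp [h1, h2]
  refine Lp.ext ?_
  have huniv : ⋃ w, cell b w = Set.univ := by
    refine Set.eq_univ_of_forall fun t => Set.mem_iUnion.2 ⟨fun i => ⌊b.repr t i⌋, ?_⟩
    rw [mem_cell_iff]; exact fun _ => rfl
  have h2 : ∀ᵐ t ∂volume.restrict (⋃ w, cell b w), f t = 0 :=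
    (ae_restrict_iUnion_iff _ _).2 hcell
  rw [huniv, Measure.restrict_univ] at h2
  filter_upwards [h2, Lp.coeFn_zero ℂ 2 (volume : Measure (Eucl m))] with t h3 h4
  rw [h3, h4]
  rfl

/-! ### Summation over frequencies -/

lemma basisChar_add (b : Basis (Fin m) ℝ (Eucl m)) (n : Fin m → ℤ) (s t : Eucl m) :
    basisChar b n (s + t) = basisChar b n s * basisChar b n t := by
  rw [basisChar, basisChar, basisChar, ← Complex.exp_add]
  congr 1
  simp only [map_add, Finsupp.add_apply, mul_add, Finset.sum_add_distrib]
  push_cast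
  ring

lemma basisChar_basisPoint (b : Basis (Fin m) ℝ (Eucl m)) (n v : Fin m → ℤ) :
    basisChar b n (basisPoint b v) = 1 := by
  simp only [basisChar, repr_basisPoint]
  rw [Complex.exp_eq_one_iff]
  refine ⟨∑ i, n i * v i, ?_⟩
  push_cast
  ring

lemma norm_basisChar (b : Basis (Fin m) ℝ (Eucl m)) (n : Fin m → ℤ) (t : Eucl m) :
    ‖basisChar b n t‖ = 1 := by
  have h : 2 * Real.pi * Complex.I * ((∑ i, n i * b.repr t i : ℝ) : ℂ)
      = ((2 * Real.pi * (∑ i, n i * b.repr t i) : ℝ) : ℂ) * Complex.I := by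
    push_cast; ring
  rw [basisChar, h, Complex.norm_exp_ofReal_mul_I]

/-- Translation by z brings the support into the fundamental domain at the price of a phase. The
phase depends only on z modulo the lattice, so it cancels in products of coefficients of functions
whose cells differ by a lattice vector. -/
lemma integral_mul_basisChar_of_support {F : Eucl m → ℂ} {z : Eucl m}
    (hF : ∀ t, t - z ∉ ZSpan.fundamentalDomain b → F t = 0) (n : Fin m → ℤ) :
    ∫ t, F t * conj (basisChar b n t) = conj (basisChar b n z) *
      ∫ u in ZSpan.fundamentalDomain b, F (u + z) * conj (basisChar b n u) := by
  rw [← integral_add_right_eq_self _ z, setIntegral_eq_integral_of_forall_compl_eq_zero,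
    ← integral_const_mul]
  · refine integral_congr_ae (Eventually.of_forall fun u => ?_)
    simp only [basisChar_add, map_mul]
    ring
  · intro u hu
    rw [hF (u + z) (by rwa [add_sub_cancel_right]), zero_mul]

/-- Parseval's identity for two functions supported in lattice translates of a fundamental
domain. -/
lemma hasSum_fourier_of_support {F H : Eucl m → ℂ} {z z' : Eucl m} {v : Fin m → ℤ}
    (hz : z - z' = basisPoint b v) (hF2 : MemLp F 2 volume) (hH2 : MemLp H 2 volume)
    (hF : ∀ t, t - z ∉ ZSpan.fundamentalDomain b → F t = 0)
    (hH : ∀ t, t - z' ∉ ZSpan.fundamentalDomain b → H t = 0) :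
    HasSum (fun n : Fin m → ℤ => (∫ t, F t * conj (basisChar b n t)) *
        conj (∫ t, H t * conj (basisChar b n t)))
      (volume.real (ZSpan.fundamentalDomain b) * ∫ t, F t * conj (H (t - basisPoint b v))) := by
  have hF' : MemLp (fun u => F (u + z)) 2 (volume.restrict (ZSpan.fundamentalDomain b)) :=
    (hF2.comp_measurePreserving (measurePreserving_add_right volume z)).restrict _
  have hH' : MemLp (fun u => H (u + z')) 2 (volume.restrict (ZSpan.fundamentalDomain b)) :=
    (hH2.comp_measurePreserving (measurePreserving_add_right volume z')).restrict _
  have key := hasSum_fourier_fundamentalDomain b volume hF' hH'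
  have hval : ∫ t, F t * conj (H (t - basisPoint b v))
      = ∫ u in ZSpan.fundamentalDomain b, F (u + z) * conj (H (u + z')) := by
    rw [← integral_add_right_eq_self _ z, setIntegral_eq_integral_of_forall_compl_eq_zero]
    · refine integral_congr_ae (Eventually.of_forall fun u => ?_)
      simp only [← hz]
      congr 3
      abel
    · intro u hu
      rw [hF (u + z) (by rwa [add_sub_cancel_right]), zero_mul]
  rw [hval]
  refine key.congr_fun fun n => ?_
  rw [integral_mul_basisChar_of_support hF, integral_mul_basisChar_of_support hH]
  have hzz : basisChar b n z = basisChar b n z' := by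
    rw [← sub_add_cancel z z', hz, basisChar_add, basisChar_basisPoint, one_mul]
  have h1 : conj (basisChar b n z') * basisChar b n z' = 1 := by
    rw [mul_comm, Complex.mul_conj, Complex.normSq_eq_norm_sq, norm_basisChar]; simp
  rw [hzz, map_mul, Complex.conj_conj]
  linear_combination ((∫ u in ZSpan.fundamentalDomain b, F (u + z) * conj (basisChar b n u)) *
    conj (∫ u in ZSpan.fundamentalDomain b, H (u + z') * conj (basisChar b n u))) * h1

/-- The product of two cell functions, the second one translated to the cell of the first. -/
noncomputable def cellProduct (b : Basis (Fin m) ℝ (Eucl m)) (v : Fin m → ℤ) (φ φ' : Eucl m → ℂ)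
    (u : Eucl m) : ℂ :=
  φ u * conj (φ' (u - basisPoint b v))

/-- The product of two windows, the second one translated. -/
noncomputable def windowProduct (x : Eucl m) (g h : L2 m) (t : Eucl m) : ℂ :=
  conj (g t) * h (t - x)

lemma integrable_cellProduct (hφ : IsCellFunction b w φ) (hφ' : IsCellFunction b w' φ')
    (v : Fin m → ℤ) : Integrable (cellProduct b v φ φ') := by
  refine (memLp_one_iff_integrable.1 (hφ.memLp 1)).mul_bdd (c := 1) ?_ (Eventually.of_forall fun t => ?_)
  · exact (Complex.continuous_conj.measurable.comp
      (hφ'.measurable.comp (measurable_id.sub_const _))).aestronglyMeasurable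
  · rw [RCLike.norm_conj]; exact hφ'.norm_le _

lemma integrable_windowProduct (x : Eucl m) (g h : L2 m) : Integrable (windowProduct x g h) := by
  have h1 : MemLp (fun t => conj (g t)) 2 (volume : Measure (Eucl m)) := (Lp.memLp g).star
  have h2 : MemLp (fun t => h (t - x)) 2 (volume : Measure (Eucl m)) :=
    (Lp.memLp h).comp_measurePreserving (measurePreserving_sub_right volume x)
  exact h1.integrable_mul h2

/-- The sum over all frequencies of the products of two short-time Fourier transforms. -/
lemma hasSum_frequencies (hφ : IsCellFunction b w φ) (hφ' : IsCellFunction b w' φ')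
    {f f' : L2 m} (hf : f =ᵐ[volume] φ) (hf' : f' =ᵐ[volume] φ') {ω : (Fin m → ℤ) → Eucl m}
    (hω : ∀ n t, character (ω n) t = basisChar b n t) (g h : L2 m) (y : Eucl m) :
    HasSum (fun n => inner ℂ (translation y (modulation (ω n) g)) f *
        inner ℂ f' (translation y (modulation (ω n) h)))
      (volume.real (ZSpan.fundamentalDomain b) * correlation (cellProduct b (w - w') φ φ')
        (windowProduct (basisPoint b (w - w')) g h) y) := by
  have hmem : ∀ {ψ : Eucl m → ℂ} {v : Fin m → ℤ}, IsCellFunction b v ψ → ∀ k : L2 m,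
      MemLp (fun t => ψ (t + y) * conj (k t)) 2 volume := by
    intro ψ v hψ k
    refine (Lp.memLp k).of_le ?_ (Eventually.of_forall fun t => ?_)
    · exact (hψ.measurable.comp (measurable_id.add_const y)).aestronglyMeasurable.mul
        (Complex.continuous_conj.comp_aestronglyMeasurable (Lp.aestronglyMeasurable k))
    · rw [norm_mul, RCLike.norm_conj]
      exact mul_le_of_le_one_left (norm_nonneg _) (hψ.norm_le _)
  have hsupp : ∀ {ψ : Eucl m → ℂ} {v : Fin m → ℤ}, IsCellFunction b v ψ → ∀ (k : L2 m) (t : Eucl m),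
      t - (basisPoint b v - y) ∉ ZSpan.fundamentalDomain b → ψ (t + y) * conj (k t) = 0 := by
    intro ψ v hψ k t ht
    rw [hψ.eq_zero (t + y), zero_mul]
    intro h
    apply ht
    have h' : t + y - basisPoint b v ∈ ZSpan.fundamentalDomain b := h
    convert h' using 1
    abel
  -- The products φ(t + y) conj(g t) and φ'(t + y) conj(h t) live in the cells of w and w' shifted
  -- by -y; the shift drops out of the difference of the two positions.
  have key := hasSum_fourier_of_support (b := b) (z := basisPoint b w - y)
    (z' := basisPoint b w' - y) (v := w - w') (by rw [basisPoint_sub]; abel)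
    (hmem hφ g) (hmem hφ' h) (hsupp hφ g) (hsupp hφ' h)
  convert key using 1
  · funext n
    rw [← inner_conj_symm f', inner_translation_modulation hf, inner_translation_modulation hf']
    simp only [hω]
  · rw [correlation]
    congr 1
    refine integral_congr_ae (Eventually.of_forall fun t => ?_)
    simp only [cellProduct, windowProduct, map_mul, Complex.conj_conj]
    rw [add_sub_right_comm]
    ring

/-- Source of the inner products in the duality conditions. The phase appears because translation
acts after modulation. -/
lemma integral_windowProduct_mul_character (x ω : Eucl m) (g h : L2 m) :
    ∫ t, windowProduct x g h t * character ω t =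
      character ω x * inner ℂ g (translation x (modulation ω h)) := by
  rw [L2.inner_def, ← integral_const_mul]
  refine integral_congr_ae ?_
  filter_upwards [translation_ae_eq (coeFn_modulation ω h) x] with t ht
  rw [ht, RCLike.inner_apply, windowProduct]
  have : character ω t = character ω x * character ω (t - x) := by
    rw [← character_add_right, add_sub_cancel]
  rw [this]
  ring

end TimeFrequency
-- The frequency lattice Aℤ^m and its dual basis
section FrequencyLattice

open Module ComplexConjugate Matrix

variable {m : ℕ}

lemma isUnit_det_transpose (A : Matrix.GeneralLinearGroup (Fin m) ℝ) :
    IsUnit (A.1.transpose).det := by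
  rw [Matrix.det_transpose]; exact (Matrix.isUnit_iff_isUnit_det _).1 A.isUnit

/-- The columns of `A⁻ᵀ`, as a basis of `ℝ^m`. -/
noncomputable def dualBasisOf (A : Matrix.GeneralLinearGroup (Fin m) ℝ) :
    Basis (Fin m) ℝ (Eucl m) :=
  Basis.ofEquivFun ((WithLp.linearEquiv 2 ℝ (Fin m → ℝ)).trans
    (Matrix.toLin'OfInv (Matrix.nonsing_inv_mul _ (isUnit_det_transpose A))
      (Matrix.mul_nonsing_inv _ (isUnit_det_transpose A))))

variable (A : Matrix.GeneralLinearGroup (Fin m) ℝ)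

lemma repr_dualBasisOf (t : Eucl m) (i : Fin m) :
    (dualBasisOf A).repr t i = (A.1.transpose.mulVec fun j => t j) i := by
  rw [dualBasisOf, Basis.ofEquivFun_repr_apply, LinearEquiv.trans_apply,
    Matrix.toLin'OfInv_apply, Matrix.toLin'_apply]
  rfl

lemma basisPoint_dualBasisOf (v : Fin m → ℤ) :
    basisPoint (dualBasisOf A) v = latticePoint (A.1.transpose)⁻¹ v := by
  apply (dualBasisOf A).repr.injective
  ext i
  rw [repr_basisPoint, repr_dualBasisOf, latticePoint]
  change _ = (A.1.transpose.mulVec ((A.1.transpose)⁻¹.mulVec fun i => (v i : ℝ))) i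
  rw [Matrix.mulVec_mulVec, Matrix.mul_nonsing_inv _ (isUnit_det_transpose A), Matrix.one_mulVec]

/-- An · t = n · Aᵀt, and Aᵀt lists the coordinates of t with respect to the columns of A⁻ᵀ. -/
lemma character_latticePoint (n : Fin m → ℤ) (t : Eucl m) :
    character (latticePoint A.1 n) t = basisChar (dualBasisOf A) n t := by
  rw [character, basisChar]
  congr 3
  simp only [repr_dualBasisOf]
  have h : inner ℝ (latticePoint A.1 n) t
      = (A.1.mulVec fun i => (n i : ℝ)) ⬝ᵥ (fun j => t j) := by
    rw [PiLp.inner_apply, dotProduct]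
    refine Finset.sum_congr rfl fun i _ => ?_
    rw [RCLike.inner_apply, mul_comm]
    rfl
  rw [h, ← Matrix.vecMul_transpose, ← Matrix.dotProduct_mulVec]
  rfl

lemma volume_fundamentalDomain_dualBasisOf :
    volume.real (ZSpan.fundamentalDomain (dualBasisOf A)) = |A.1.det|⁻¹ := by
  set b₀ := (EuclideanSpace.basisFun (Fin m) ℝ).toBasis with hb₀
  have h1 : volume.real (ZSpan.fundamentalDomain b₀) = 1 := by
    have e : ZSpan.fundamentalDomain b₀ = (MeasurableEquiv.toLp 2 (Fin m → ℝ)).symm ⁻¹'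
        (Set.univ.pi fun _ => Set.Ico (0 : ℝ) 1) := by
      ext t
      simp [ZSpan.mem_fundamentalDomain, hb₀]
    rw [e, Measure.real, (EuclideanSpace.volume_preserving_symm_measurableEquiv_toLp
      (Fin m)).measure_preimage_equiv, volume_pi_pi]
    simp
  rw [ZSpan.measureReal_fundamentalDomain (dualBasisOf A) volume b₀, h1, mul_one]
  have h2 : b₀.toMatrix (dualBasisOf A) = (A.1.transpose)⁻¹ := by
    ext i j
    have h3 : dualBasisOf A j = latticePoint (A.1.transpose)⁻¹ (Pi.single j 1) := by
      rw [← basisPoint_dualBasisOf, basisPoint, Finset.sum_eq_single j]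
      · simp
      · intro k _ hk; simp [hk]
      · simp
    rw [Basis.toMatrix_apply, h3]
    have h4 : (fun i => ((Pi.single j 1 : Fin m → ℤ) i : ℝ)) = Pi.single j 1 := by
      ext k
      by_cases hk : k = j
      · subst hk; simp
      · simp [hk]
    simp only [hb₀, latticePoint, h4, Matrix.mulVec_single_one]
    simp
  rw [Basis.det_apply, h2, Matrix.det_nonsing_inv, Ring.inverse_eq_inv', Matrix.det_transpose,
    abs_inv]

end FrequencyLattice
-- Sums over a model set as values of a periodization
section ModelSetSums

variable {m : ℕ} {Γ : Submodule ℤ (Eucl m × ℝ)} {a : ℝ} {K : Eucl m → ℂ}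

/-- The lattice points in the strip over the window correspond to the points of the model set. -/
noncomputable def stripEquiv (hΓ : Set.InjOn Prod.fst (Γ : Set (Eucl m × ℝ))) (a : ℝ) :
    {γ : Γ | |(γ : Eucl m × ℝ).2| ≤ a} ≃ modelSet Γ (Set.Icc (-a) a) :=
  Equiv.ofBijective (fun γ => ⟨(γ.1 : Eucl m × ℝ).1, γ.1, γ.1.2, abs_le.1 γ.2, rfl⟩)
    ⟨fun γ γ' h => by
      have h1 : (γ.1 : Eucl m × ℝ) = γ'.1 := hΓ γ.1.2 γ'.1.2 (congrArg Subtype.val h)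
      exact Subtype.ext (Subtype.ext h1),
    fun ⟨x, γ, hγ, h2, h1⟩ => ⟨⟨⟨γ, hγ⟩, abs_le.2 h2⟩, Subtype.ext h1⟩⟩

lemma periodized_eq_of_hasSum (hΓ : Set.InjOn Prod.fst (Γ : Set (Eucl m × ℝ))) {x : Eucl m}
    {s : ℂ} (h : HasSum (fun y : modelSet Γ (Set.Icc (-a) a) => K ((y : Eucl m) + x)) s) :
    periodized Γ a K (x, 0) = s := by
  rw [← (stripEquiv hΓ a).hasSum_iff] at h
  have h1 : HasSum ((fun γ : Γ => K ((γ : Eucl m × ℝ).1 + x)) ∘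
      ((↑) : {γ : Γ | |(γ : Eucl m × ℝ).2| ≤ a} → Γ)) s := h
  rw [hasSum_subtype_iff_indicator] at h1
  rw [periodized, ← h1.tsum_eq]
  refine tsum_congr fun γ => ?_
  by_cases hγ : |(γ : Eucl m × ℝ).2| ≤ a
  · rw [Set.indicator_of_mem (show γ ∈ {γ : Γ | |(γ : Eucl m × ℝ).2| ≤ a} from hγ), windowed,
      if_pos (by simpa using hγ)]
    rfl
  · rw [Set.indicator_of_notMem (show γ ∉ {γ : Γ | |(γ : Eucl m × ℝ).2| ≤ a} from hγ), windowed,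
      if_neg (by simpa using hγ)]

/-- A window of length `5a/2` is covered by two translates of `[-a, a]` along `p₂(Γ)`, so that
bounds along the model set yield bounds along its translates. -/
lemma hasModelSetBound_of_tsum_le (hΓ : IsCutAndProject Γ) (ha : 0 < a) {M : ℝ}
    (hs : ∀ x, Summable fun y : modelSet Γ (Set.Icc (-a) a) => ‖K ((y : Eucl m) + x)‖)
    (hM : ∀ x, ∑' y : modelSet Γ (Set.Icc (-a) a), ‖K ((y : Eucl m) + x)‖ ≤ M) :
    HasModelSetBound Γ a K (2 * M) := by
  classical
  have hstrip : ∀ (x : Eucl m) (S : Finset Γ), (∀ γ ∈ S, |(γ : Eucl m × ℝ).2| ≤ a) →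
      ∑ γ ∈ S, ‖K ((γ : Eucl m × ℝ).1 + x)‖ ≤ M := by
    intro x S hS
    have h1 := (stripEquiv hΓ.injOn_fst a).summable_iff.2 (hs x)
    have h2 := (stripEquiv hΓ.injOn_fst a).tsum_eq
      (fun y : modelSet Γ (Set.Icc (-a) a) => ‖K ((y : Eucl m) + x)‖)
    have h3 := h1.sum_le_tsum (S.subtype fun γ => γ ∈ {γ : Γ | |(γ : Eucl m × ℝ).2| ≤ a})
      (fun _ _ => norm_nonneg _)
    rw [← Finset.sum_subtype_of_mem (p := fun γ => γ ∈ {γ : Γ | |(γ : Eucl m × ℝ).2| ≤ a})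
      (fun γ : Γ => ‖K ((γ : Eucl m × ℝ).1 + x)‖) hS]
    exact h3.trans ((le_of_eq h2).trans (hM x))
  -- Adding γ₀ moves the displaced window back to [-a, a] and changes only x, in which the bound is
  -- uniform.
  have hshift : ∀ (γ₀ : Γ) (x : Eucl m) (S : Finset Γ),
      ∑ γ ∈ S.filter (fun γ : Γ => |(γ : Eucl m × ℝ).2 + (γ₀ : Eucl m × ℝ).2| ≤ a),
        ‖K ((γ : Eucl m × ℝ).1 + x)‖ ≤ M := by
    intro γ₀ x S
    have h1 := hstrip (x - (γ₀ : Eucl m × ℝ).1)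
      ((S.filter (fun γ : Γ => |(γ : Eucl m × ℝ).2 + (γ₀ : Eucl m × ℝ).2| ≤ a)).map
        (Equiv.addRight γ₀).toEmbedding) (by
        intro γ hγ
        obtain ⟨γ', hγ', rfl⟩ := Finset.mem_map.1 hγ
        exact (Finset.mem_filter.1 hγ').2)
    rw [Finset.sum_map] at h1
    refine le_trans (le_of_eq (Finset.sum_congr rfl fun γ _ => ?_)) h1
    congr 2
    simp
  intro x s S hS
  -- If γ.2 + s lies in [0, 5a/4], then γ.2 + γ₁.2 lies in (-a/2, a); γ₂ serves the negative half in
  -- the same way.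
  obtain ⟨_, ⟨γ₁, hγ₁, rfl⟩, h1⟩ := hΓ.dense_snd.exists_between
    (show s - a / 2 < s - a / 4 by linarith)
  obtain ⟨_, ⟨γ₂, hγ₂, rfl⟩, h2⟩ := hΓ.dense_snd.exists_between
    (show s + a / 4 < s + a / 2 by linarith)
  have hcov : S ⊆ S.filter (fun γ : Γ => |(γ : Eucl m × ℝ).2 + γ₁.2| ≤ a) ∪
      S.filter (fun γ : Γ => |(γ : Eucl m × ℝ).2 + γ₂.2| ≤ a) := by
    intro γ hγ
    rw [Finset.mem_union, Finset.mem_filter, Finset.mem_filter]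
    have h := abs_le.1 (hS γ hγ)
    rcases le_total 0 ((γ : Eucl m × ℝ).2 + s) with h0 | h0
    · exact Or.inl ⟨hγ, abs_le.2 ⟨by linarith [h1.1], by linarith [h1.2]⟩⟩
    · exact Or.inr ⟨hγ, abs_le.2 ⟨by linarith [h2.1], by linarith [h2.2]⟩⟩
  calc ∑ γ ∈ S, ‖K ((γ : Eucl m × ℝ).1 + x)‖
      ≤ ∑ γ ∈ S.filter (fun γ : Γ => |(γ : Eucl m × ℝ).2 + γ₁.2| ≤ a) ∪
        S.filter (fun γ : Γ => |(γ : Eucl m × ℝ).2 + γ₂.2| ≤ a), ‖K ((γ : Eucl m × ℝ).1 + x)‖ :=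
        Finset.sum_le_sum_of_subset_of_nonneg hcov fun _ _ _ => norm_nonneg _
    _ ≤ ∑ γ ∈ S.filter (fun γ : Γ => |(γ : Eucl m × ℝ).2 + γ₁.2| ≤ a), ‖K ((γ : Eucl m × ℝ).1 + x)‖
        + ∑ γ ∈ S.filter (fun γ : Γ => |(γ : Eucl m × ℝ).2 + γ₂.2| ≤ a),
          ‖K ((γ : Eucl m × ℝ).1 + x)‖ := by
        rw [← Finset.sum_union_inter]
        exact le_add_of_nonneg_right (Finset.sum_nonneg fun _ _ => norm_nonneg _)
    _ ≤ 2 * M := by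
        rw [two_mul]
        exact add_le_add (hshift ⟨γ₁, hγ₁⟩ x S) (hshift ⟨γ₂, hγ₂⟩ x S)

end ModelSetSums

/-! ### The Gabor kernel and its sums along the model set -/

section GaborKernel

open Module ComplexConjugate

variable {m L : ℕ}

/-- The sum over all windows and frequencies of the products of the short-time Fourier transforms
of two cell functions. -/
noncomputable def gaborKernel (b : Basis (Fin m) ℝ (Eucl m)) (v : Fin m → ℤ) (φ φ' : Eucl m → ℂ)
    (g h : Fin L → L2 m) (y : Eucl m) : ℂ :=
  ∑ l, (volume.real (ZSpan.fundamentalDomain b) : ℂ) *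
    correlation (cellProduct b v φ φ') (windowProduct (basisPoint b v) (g l) (h l)) y

variable {b : Basis (Fin m) ℝ (Eucl m)} {w w' : Fin m → ℤ} {φ φ' : Eucl m → ℂ}

lemma integrable_gaborKernel (hφ : IsCellFunction b w φ) (hφ' : IsCellFunction b w' φ')
    (v : Fin m → ℤ) (g h : Fin L → L2 m) : Integrable (gaborKernel b v φ φ' g h) :=
  integrable_finsetSum _ fun l _ => (integrable_correlation (integrable_cellProduct hφ hφ' v)
    (integrable_windowProduct (basisPoint b v) (g l) (h l))).const_mul _

/-- The Fourier transform of the Gabor kernel. -/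
lemma integral_gaborKernel_mul (hφ : IsCellFunction b w φ) (hφ' : IsCellFunction b w' φ')
    (v : Fin m → ℤ) (g h : Fin L → L2 m) (ω : Eucl m) :
    ∫ y, gaborKernel b v φ φ' g h y * conj (character ω y) =
      (∫ u, cellProduct b v φ φ' u * conj (character ω u)) * character ω (basisPoint b v) *
        (volume.real (ZSpan.fundamentalDomain b) *
          ∑ l, inner ℂ (g l) (translation (basisPoint b v) (modulation ω (h l)))) := by
  have hp := integrable_cellProduct hφ hφ' v
  simp only [gaborKernel, Finset.sum_mul]
  rw [integral_finsetSum]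
  · rw [Finset.mul_sum, Finset.mul_sum]
    refine Finset.sum_congr rfl fun l _ => ?_
    simp only [mul_assoc]
    rw [integral_const_mul, integral_correlation_mul hp (integrable_windowProduct _ _ _),
      integral_windowProduct_mul_character]
    ring
  · intro l _
    exact integrable_mul_conj_character ((integrable_correlation hp
      (integrable_windowProduct (basisPoint b v) (g l) (h l))).const_mul _) ω

/-- Reordering of the index set of a Gabor system. -/
def gaborIndexEquiv (L : ℕ) (Λ : Set (Eucl m)) :
    Λ × (Fin L × (Fin m → ℤ)) ≃ Fin L × Λ × (Fin m → ℤ) where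
  toFun p := (p.2.1, p.1, p.2.2)
  invFun q := (q.2.1, q.1, q.2.2)
  left_inv _ := rfl
  right_inv _ := rfl

variable {Λ : Set (Eucl m)} {B : Matrix (Fin m) (Fin m) ℝ} {g h : Fin L → L2 m} {f f' : L2 m}

lemma hasSum_gaborKernel_fiber (hB : ∀ n t, character (latticePoint B n) t = basisChar b n t)
    (hφ : IsCellFunction b w φ) (hφ' : IsCellFunction b w' φ')
    (hf : f =ᵐ[volume] φ) (hf' : f' =ᵐ[volume] φ') (y : Eucl m)
    (hs : Summable fun j : Fin L × (Fin m → ℤ) =>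
      inner ℂ (translation y (modulation (latticePoint B j.2) (g j.1))) f *
        inner ℂ f' (translation y (modulation (latticePoint B j.2) (h j.1)))) :
    HasSum (fun j : Fin L × (Fin m → ℤ) =>
      inner ℂ (translation y (modulation (latticePoint B j.2) (g j.1))) f *
        inner ℂ f' (translation y (modulation (latticePoint B j.2) (h j.1))))
      (gaborKernel b (w - w') φ φ' g h y) := by
  have h1 := hs.hasSum.prod_fiberwise fun l =>
    hasSum_frequencies hφ hφ' hf hf' hB (g l) (h l) y
  have h2 := h1.unique (hasSum_fintype _)
  rw [gaborKernel, ← h2]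
  exact hs.hasSum

/-- Translating the argument by -x amounts to translating the model set by x; this turns matrix
coefficients into functions of x. -/
lemma inner_gaborSystem_translation (x : Eucl m) (f : L2 m) (i : Fin L × Λ × (Fin m → ℤ)) :
    inner ℂ (gaborSystem g Λ B i) (translation (-x) f) =
      inner ℂ (translation ((i.2.1 : Eucl m) + x) (modulation (latticePoint B i.2.2) (g i.1))) f := by
  rw [gaborSystem, ← inner_translation_translation x, translation_translation,
    translation_translation, add_neg_cancel, translation_zero, add_comm x]

/-- The absolute sums of the Gabor kernel along translates of `Λ` are bounded, by the Bessel
property. -/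
lemma gaborKernel_bound (hB : ∀ n t, character (latticePoint B n) t = basisChar b n t)
    (hφ : IsCellFunction b w φ) (hφ' : IsCellFunction b w' φ')
    (hf : f =ᵐ[volume] φ) (hf' : f' =ᵐ[volume] φ') (hg : IsBessel (gaborSystem g Λ B))
    (hh : IsBessel (gaborSystem h Λ B)) :
    ∃ M : ℝ, ∀ x, (Summable fun y : Λ => ‖gaborKernel b (w - w') φ φ' g h ((y : Eucl m) + x)‖) ∧
      ∑' y : Λ, ‖gaborKernel b (w - w') φ φ' g h ((y : Eucl m) + x)‖ ≤ M := by
  obtain ⟨Bg, -, hg⟩ := hg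
  obtain ⟨Bh, -, hh⟩ := hh
  -- From |αβ| ≤ |α|² + |β|² and the two Bessel bounds; translations preserve the norm, so the
  -- constant is independent of x.
  refine ⟨Bg * ‖f‖ ^ 2 + Bh * ‖f'‖ ^ 2, fun x => ?_⟩
  obtain ⟨hg1, hg2⟩ := hg (translation (-x) f)
  obtain ⟨hh1, hh2⟩ := hh (translation (-x) f')
  rw [norm_translation] at hg2 hh2
  set κ : Fin L × Λ × (Fin m → ℤ) → ℂ := fun i =>
    inner ℂ (translation ((i.2.1 : Eucl m) + x) (modulation (latticePoint B i.2.2) (g i.1))) f *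
      inner ℂ f' (translation ((i.2.1 : Eucl m) + x) (modulation (latticePoint B i.2.2) (h i.1)))
    with hκ
  have hle : ∀ i, ‖κ i‖ ≤ ‖inner ℂ (gaborSystem g Λ B i) (translation (-x) f)‖ ^ 2 +
      ‖inner ℂ (gaborSystem h Λ B i) (translation (-x) f')‖ ^ 2 := by
    intro i
    rw [inner_gaborSystem_translation, inner_gaborSystem_translation, hκ, norm_mul,
      norm_inner_symm f']
    nlinarith [sq_nonneg (‖inner ℂ (translation ((i.2.1 : Eucl m) + x)
      (modulation (latticePoint B i.2.2) (g i.1))) f‖ - ‖inner ℂ (translation ((i.2.1 : Eucl m) + x)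
      (modulation (latticePoint B i.2.2) (h i.1))) f'‖), sq_nonneg ‖inner ℂ (translation
      ((i.2.1 : Eucl m) + x) (modulation (latticePoint B i.2.2) (g i.1))) f‖,
      sq_nonneg ‖inner ℂ (translation ((i.2.1 : Eucl m) + x)
      (modulation (latticePoint B i.2.2) (h i.1))) f'‖]
  have hsum : Summable fun i => ‖κ i‖ :=
    Summable.of_nonneg_of_le (fun _ => norm_nonneg _) hle (hg1.add hh1)
  have htot : ∑' i, ‖κ i‖ ≤ Bg * ‖f‖ ^ 2 + Bh * ‖f'‖ ^ 2 :=
    (hsum.tsum_le_tsum hle (hg1.add hh1)).trans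
      ((hg1.tsum_add hh1).trans_le (add_le_add hg2 hh2))
  have hsum' : Summable fun p => ‖κ (gaborIndexEquiv L Λ p)‖ :=
    (gaborIndexEquiv L Λ).summable_iff.2 hsum
  have hfib : ∀ y : Λ, ‖gaborKernel b (w - w') φ φ' g h ((y : Eucl m) + x)‖ ≤
      ∑' j, ‖κ (gaborIndexEquiv L Λ (y, j))‖ := by
    intro y
    have h1 := hsum'.prod_factor y
    have h2 := hasSum_gaborKernel_fiber (g := g) (h := h) hB hφ hφ' hf hf' ((y : Eucl m) + x)
      h1.of_norm
    rw [← h2.tsum_eq]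
    exact norm_tsum_le_tsum_norm h1
  have hs1 : Summable fun y : Λ => ‖gaborKernel b (w - w') φ φ' g h ((y : Eucl m) + x)‖ :=
    Summable.of_nonneg_of_le (fun _ => norm_nonneg _) hfib hsum'.prod
  refine ⟨hs1, (hs1.tsum_le_tsum hfib hsum'.prod).trans ?_⟩
  rw [← hsum'.tsum_prod, (gaborIndexEquiv L Λ).tsum_eq (fun i => ‖κ i‖)]
  exact htot

/-- The matrix coefficients of the mixed frame operator, with translated arguments, are sums of
the Gabor kernel along translates of `Λ`. -/
lemma hasSum_gaborKernel (hB : ∀ n t, character (latticePoint B n) t = basisChar b n t)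
    (hφ : IsCellFunction b w φ) (hφ' : IsCellFunction b w' φ')
    (hf : f =ᵐ[volume] φ) (hf' : f' =ᵐ[volume] φ') {T : L2 m →L[ℂ] L2 m}
    (hT : ∀ f, HasSum (fun i => inner ℂ (gaborSystem g Λ B i) f • gaborSystem h Λ B i) (T f))
    (x : Eucl m) :
    HasSum (fun y : Λ => gaborKernel b (w - w') φ φ' g h ((y : Eucl m) + x))
      (inner ℂ (translation (-x) f') (T (translation (-x) f))) := by
  have h1 := hasSum_inner_frameOperator hT (translation (-x) f) (translation (-x) f')
  set κ : Fin L × Λ × (Fin m → ℤ) → ℂ := fun i =>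
    inner ℂ (translation ((i.2.1 : Eucl m) + x) (modulation (latticePoint B i.2.2) (g i.1))) f *
      inner ℂ f' (translation ((i.2.1 : Eucl m) + x) (modulation (latticePoint B i.2.2) (h i.1)))
    with hκ
  have h2 : ∀ i, inner ℂ (gaborSystem g Λ B i) (translation (-x) f) *
      inner ℂ (translation (-x) f') (gaborSystem h Λ B i) = κ i := by
    intro i
    rw [← inner_conj_symm (translation (-x) f'), inner_gaborSystem_translation,
      inner_gaborSystem_translation, inner_conj_symm]
  rw [funext h2] at h1
  have h3 : HasSum (fun p => κ (gaborIndexEquiv L Λ p))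
      (inner ℂ (translation (-x) f') (T (translation (-x) f))) :=
    (gaborIndexEquiv L Λ).hasSum_iff.2 h1
  refine h3.prod_fiberwise fun y => ?_
  have h4 := h3.summable.prod_factor y
  have h5 := hasSum_gaborKernel_fiber (g := g) (h := h) hB hφ hφ' hf hf' ((y : Eucl m) + x) h4
  exact h5

end GaborKernel
-- Duality in terms of Fourier coefficients
section Duality

open Module ComplexConjugate

variable {m L : ℕ} {Γ : Submodule ℤ (Eucl m × ℝ)} {a : ℝ} {b : Basis (Fin m) ℝ (Eucl m)}
  {w w' : Fin m → ℤ} {φ φ' : Eucl m → ℂ} {B : Matrix (Fin m) (Fin m) ℝ} {g h : Fin L → L2 m}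
  {f f' : L2 m} {T : L2 m →L[ℂ] L2 m}

section

variable [DiscreteTopology Γ] [IsZLattice ℝ Γ]

/-- The translated matrix coefficients of the mixed frame operator are constant if and only if
the Fourier–Bohr coefficients are those of a constant. -/
lemma frameOperator_const_iff (hΓ : IsCutAndProject Γ) (ha : 0 < a)
    (hgen : ∀ γ : Γ, |(γ : Eucl m × ℝ).2| ≠ a)
    (hB : ∀ n t, character (latticePoint B n) t = basisChar b n t)
    (hφ : IsCellFunction b w φ) (hφ' : IsCellFunction b w' φ')
    (hf : f =ᵐ[volume] φ) (hf' : f' =ᵐ[volume] φ')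
    (hgB : IsBessel (gaborSystem g (modelSet Γ (Set.Icc (-a) a)) B))
    (hhB : IsBessel (gaborSystem h (modelSet Γ (Set.Icc (-a) a)) B))
    (hT : ∀ f, HasSum (fun i => inner ℂ (gaborSystem g (modelSet Γ (Set.Icc (-a) a)) B i) f •
      gaborSystem h (modelSet Γ (Set.Icc (-a) a)) B i) (T f)) (c : ℂ) :
    (∀ x, inner ℂ (translation (-x) f') (T (translation (-x) f)) = c) ↔ ∀ η ∈ dualLattice Γ,
      ((2 * a * Real.sinc (Real.pi * (η.2 * (2 * a))) : ℝ) : ℂ) *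
        ((∫ u, cellProduct b (w - w') φ φ' u * conj (character η.1 u)) *
          character η.1 (basisPoint b (w - w')) *
        (volume.real (ZSpan.fundamentalDomain b) *
          ∑ l, inner ℂ (g l) (translation (basisPoint b (w - w')) (modulation η.1 (h l)))))
      = if η = 0 then c * latticeCovol Γ else 0 := by
  obtain ⟨M, hM⟩ := gaborKernel_bound hB hφ hφ' hf hf' hgB hhB
  have hK := hasModelSetBound_of_tsum_le hΓ ha (fun x => (hM x).1) (fun x => (hM x).2)
  have hper : ∀ x, periodized Γ a (gaborKernel b (w - w') φ φ' g h) (x, 0) =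
      inner ℂ (translation (-x) f') (T (translation (-x) f)) := fun x =>
    periodized_eq_of_hasSum hΓ.injOn_fst (hasSum_gaborKernel hB hφ hφ' hf hf' hT x)
  -- Continuity comes from the matrix coefficients, through strong continuity of translations, not
  -- from the sum.
  have hcont : Continuous fun x => periodized Γ a (gaborKernel b (w - w') φ φ' g h) (x, 0) := by
    simp only [hper]
    have h1 := (continuous_translation f').comp (continuous_neg (G := Eucl m))
    have h2 := T.continuous.comp ((continuous_translation f).comp (continuous_neg (G := Eucl m)))
    exact h1.inner h2
  have key := periodized_eq_const_iff hΓ ha hgen hK (integrable_gaborKernel hφ hφ' _ g h) hcont c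
  simp only [hper, integral_gaborKernel_mul hφ hφ'] at key
  exact key

end

lemma inner_eq_integral_of_ae {f f' : L2 m} (hf : f =ᵐ[volume] φ) (hf' : f' =ᵐ[volume] φ') :
    inner ℂ f' f = ∫ u, φ u * conj (φ' u) := by
  rw [L2.inner_def]
  refine integral_congr_ae ?_
  filter_upwards [hf, hf'] with t h1 h2
  rw [h1, h2, RCLike.inner_apply]

lemma inner_eq_zero_of_cell_ne (hφ : IsCellFunction b w φ) (hφ' : IsCellFunction b w' φ')
    (hf : f =ᵐ[volume] φ) (hf' : f' =ᵐ[volume] φ') (hw : w ≠ w') : inner ℂ f' f = 0 := by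
  rw [inner_eq_integral_of_ae hf hf']
  refine integral_eq_zero_of_ae (Eventually.of_forall fun t => ?_)
  by_cases ht : t ∈ cell b w
  · have ht' : t ∉ cell b w' := fun ht' => hw <| funext fun i => by
      rw [← (mem_cell_iff b w t).1 ht i, (mem_cell_iff b w' t).1 ht' i]
    simp [hφ'.eq_zero t ht']
  · simp [hφ.eq_zero t ht]

/-- The test pair for the condition at (η, v), with ω = p₁*(η): translation by v carries the cell of
-v onto the cell of 0, so the coefficient at ω is a volume, in particular nonzero. -/
lemma integral_cellProduct_character (b : Basis (Fin m) ℝ (Eucl m)) (v : Fin m → ℤ)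
    (ω : Eucl m) :
    ∫ u, cellProduct b v ((cell b 0).indicator (character ω)) ((cell b (-v)).indicator 1) u *
      conj (character ω u) = volume.real (ZSpan.fundamentalDomain b) := by
  have h1 : ∀ u, cellProduct b v ((cell b 0).indicator (character ω))
      ((cell b (-v)).indicator 1) u * conj (character ω u) =
      (cell b 0).indicator (fun _ => (1 : ℂ)) u := by
    intro u
    by_cases hu : u ∈ cell b 0
    · have hu' : u - basisPoint b v ∈ cell b (-v) := by
        rw [mem_cell_iff] at hu ⊢
        intro i
        rw [map_sub, Finsupp.sub_apply, repr_basisPoint, Int.floor_sub_intCast, hu i]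
        simp
      rw [cellProduct, Set.indicator_of_mem hu, Set.indicator_of_mem hu, Set.indicator_of_mem hu',
        Pi.one_apply, map_one, mul_one, mul_comm, conj_character_mul_self]
    · rw [cellProduct, Set.indicator_of_notMem hu, Set.indicator_of_notMem hu, zero_mul, zero_mul]
  simp only [h1]
  rw [integral_indicator (measurableSet_cell b 0), setIntegral_const, Measure.real, volume_cell]
  simp [Measure.real]

variable [DiscreteTopology Γ] [IsZLattice ℝ Γ]

/-- Duality of Gabor systems over a model set with window `[-a, a]`, in terms of the
coefficients of the Janssen representation. -/
theorem isDualSystem_gaborSystem_iff (hΓ : IsCutAndProject Γ) (ha : 0 < a)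
    (hgen : ∀ γ : Γ, |(γ : Eucl m × ℝ).2| ≠ a)
    (hB : ∀ n t, character (latticePoint B n) t = basisChar b n t)
    (hgB : IsBessel (gaborSystem g (modelSet Γ (Set.Icc (-a) a)) B))
    (hhB : IsBessel (gaborSystem h (modelSet Γ (Set.Icc (-a) a)) B)) :
    IsDualSystem (gaborSystem h (modelSet Γ (Set.Icc (-a) a)) B)
        (gaborSystem g (modelSet Γ (Set.Icc (-a) a)) B) ↔
      ∀ η ∈ dualLattice Γ, ∀ v : Fin m → ℤ,
        ((2 * a / latticeCovol Γ : ℝ) : ℂ) * (volume.real (ZSpan.fundamentalDomain b) : ℂ) *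
          (Real.sinc (Real.pi * (η.2 * (2 * a))) : ℂ) *
          ∑ l, inner ℂ (g l) (translation (basisPoint b v) (modulation η.1 (h l))) =
        if η = 0 ∧ v = 0 then 1 else 0 := by
  have hcov : (latticeCovol Γ : ℂ) ≠ 0 := by exact_mod_cast (latticeCovol_pos Γ).ne'
  have hvol : (volume.real (ZSpan.fundamentalDomain b) : ℂ) ≠ 0 := by
    exact_mod_cast (measureReal_fundamentalDomain_pos b (volume : Measure (Eucl m))).ne'
  obtain ⟨T, hT⟩ := hgB.exists_frameOperator hhB
  rw [isDualSystem_iff hT (eq_zero_of_inner_cellFunction_eq_zero b)]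
  constructor
  · intro hdual η hη v
    have hid : ∀ f, T f = f := by
      intro f
      have := (isDualSystem_iff hT (eq_zero_of_inner_cellFunction_eq_zero b)).2 hdual f
      exact (hT f).unique this
    have hφ : IsCellFunction b 0 ((cell b 0).indicator (character η.1)) :=
      IsCellFunction.indicator b 0 (continuous_character η.1).measurable
        fun t => (norm_character η.1 t).le
    have hφ' : IsCellFunction b (-v) ((cell b (-v)).indicator (1 : Eucl m → ℂ)) :=
      IsCellFunction.indicator b (-v) measurable_one fun t => by simp
    have hf := (hφ.memLp 2).coeFn_toLp
    have hf' := (hφ'.memLp 2).coeFn_toLp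
    -- For T = id the translated coefficients all equal ⟨f, f'⟩; here w - w' = 0 - (-v) = v.
    have key := (frameOperator_const_iff hΓ ha hgen hB hφ hφ' hf hf' hgB hhB hT
      (inner ℂ ((hφ'.memLp 2).toLp _) ((hφ.memLp 2).toLp _))).1
      (fun x => by rw [hid, inner_translation_translation]) η hη
    rw [sub_neg_eq_add, zero_add, integral_cellProduct_character] at key
    have hc : v ≠ 0 → inner ℂ ((hφ'.memLp 2).toLp _) ((hφ.memLp 2).toLp _) = (0 : ℂ) := fun hv =>
      inner_eq_zero_of_cell_ne hφ hφ' hf hf' fun h0 => hv (neg_eq_zero.1 h0.symm)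
    have hc0 : η = 0 → v = 0 → inner ℂ ((hφ'.memLp 2).toLp _) ((hφ.memLp 2).toLp _)
        = (volume.real (ZSpan.fundamentalDomain b) : ℂ) := by
      intro hη0 hv0
      rw [inner_eq_integral_of_ae hf hf', ← integral_cellProduct_character b v η.1]
      refine integral_congr_ae (Eventually.of_forall fun u => ?_)
      simp only [cellProduct, hη0, hv0, basisPoint_zero, sub_zero, Prod.fst_zero, character,
        inner_zero_left, Complex.ofReal_zero, mul_zero, Complex.exp_zero, map_one, mul_one]
    have hchar : conj (character η.1 (basisPoint b v)) * character η.1 (basisPoint b v) = 1 :=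
      conj_character_mul_self _ _
    set J := ∑ l, inner ℂ (g l) (translation (basisPoint b v) (modulation η.1 (h l)))
    set χ := character η.1 (basisPoint b v) with hχ
    set V := (volume.real (ZSpan.fundamentalDomain b) : ℂ)
    -- The condition is multiplied by V · covol to match `key`, and the unimodular phase χ is
    -- cancelled by its conjugate.
    have hX : ((2 * a / latticeCovol Γ : ℝ) : ℂ) * V *
        (Real.sinc (Real.pi * (η.2 * (2 * a))) : ℂ) * J * (V * latticeCovol Γ) =
        conj χ * (if η = 0 then inner ℂ ((hφ'.memLp 2).toLp _) ((hφ.memLp 2).toLp _) *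
          (latticeCovol Γ : ℂ) else 0) := by
      rw [← key]
      have e : ((2 * a / latticeCovol Γ : ℝ) : ℂ) * latticeCovol Γ = 2 * a := by
        push_cast
        exact div_mul_cancel₀ _ hcov
      push_cast at e ⊢
      linear_combination (V * (Real.sinc (Real.pi * (η.2 * (2 * a))) : ℂ) * J * V) * e -
        (2 * a * (Real.sinc (Real.pi * (η.2 * (2 * a))) : ℂ) * V * V * J) * hchar
    refine mul_right_cancel₀ (mul_ne_zero hvol hcov) (hX.trans ?_)
    by_cases hη0 : η = 0
    · by_cases hv0 : v = 0
      · have hχ1 : χ = 1 := by rw [hχ, hη0]; simp [character]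
        rw [if_pos hη0, if_pos ⟨hη0, hv0⟩, hc0 hη0 hv0, hχ1, map_one]
      · rw [if_pos hη0, if_neg (fun h => hv0 h.2), hc hv0]; simp
    · rw [if_neg hη0, if_neg (fun h => hη0 h.1)]; simp
  · rintro hcoef f ⟨w, φ, hφ, hf⟩ f' ⟨w', φ', hφ', hf'⟩
    -- The coefficients are shown to be those of the constant ⟨f, f'⟩, and the conclusion is read
    -- off at x = 0.
    have key := (frameOperator_const_iff hΓ ha hgen hB hφ hφ' hf hf' hgB hhB hT
      (inner ℂ f' f)).2 (fun η hη => ?_) 0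
    · simpa [translation_zero] using key
    · have h1 := hcoef η hη (w - w')
      set J := ∑ l, inner ℂ (g l) (translation (basisPoint b (w - w')) (modulation η.1 (h l)))
      have e : ((2 * a / latticeCovol Γ : ℝ) : ℂ) * latticeCovol Γ = 2 * a := by
        push_cast
        exact div_mul_cancel₀ _ hcov
      have h2 : ∀ I χ : ℂ, ((2 * a * Real.sinc (Real.pi * (η.2 * (2 * a))) : ℝ) : ℂ) *
          (I * χ * (volume.real (ZSpan.fundamentalDomain b) * J)) =
          I * χ * latticeCovol Γ * (if η = 0 ∧ w - w' = 0 then 1 else 0) := by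
        intro I χ
        rw [← h1]
        push_cast at e ⊢
        linear_combination (-(I * χ * (volume.real (ZSpan.fundamentalDomain b) : ℂ) * J *
          (Real.sinc (Real.pi * (η.2 * (2 * a))) : ℂ))) * e
      rw [h2]
      by_cases hη0 : η = 0
      · by_cases hw : w - w' = 0
        · rw [if_pos ⟨hη0, hw⟩, if_pos hη0, mul_one, hw, hη0, inner_eq_integral_of_ae hf hf']
          simp [character, cellProduct, basisPoint_zero]
        · rw [if_neg (fun h => hw h.2), if_pos hη0,
            inner_eq_zero_of_cell_ne hφ hφ' hf hf' (sub_ne_zero.1 hw)]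
          simp
      · rw [if_neg (fun h => hη0 h.1), if_neg hη0, mul_zero]

end Duality
end ModelSetGabor

/-! ### The duality theorem -/

theorem theorem5p4 {m L : ℕ}
    (Γ : Submodule ℤ (Eucl m × ℝ)) [DiscreteTopology Γ] [IsZLattice ℝ Γ]
    (hΓ : IsCutAndProject Γ)
    (Ω : Set ℝ) (hΩ : IsIntervalWindow Ω) (hsymm : ∀ x ∈ Ω, -x ∈ Ω) (hgen : IsGeneric Γ Ω)
    (ε : ℝ) (hε0 : 0 < ε) (hε1 : ε < 1)
    (A : Matrix.GeneralLinearGroup (Fin m) ℝ)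
    (g h : Fin L → L2 m)
    (hgW : ∀ l, MemAmalgam (g l)) (hhW : ∀ l, MemAmalgam (h l))
    (hgB : IsBessel (gaborSystem g (modelSet Γ Ω) A.1))
    (hhB : IsBessel (gaborSystem h (modelSet Γ Ω) A.1)) :
    ∃ D : ℝ, HasDensity (modelSet Γ Ω) D ∧
      (IsDualSystem (gaborSystem h (modelSet Γ Ω) A.1) (gaborSystem g (modelSet Γ Ω) A.1) ↔
        ∀ (η : dualLattice Γ) (v : Fin m → ℤ),
          (D : ℂ) * ((|A.1.det|⁻¹ : ℝ) : ℂ) * (Phi Ω ε (-(η : Eucl m × ℝ).2) : ℂ) *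
            ∑ l, inner ℂ (g l)
              (translation (latticePoint (A.1.transpose)⁻¹ v)
                (modulation (η : Eucl m × ℝ).1 (h l)))
          = if η = 0 ∧ v = 0 then 1 else 0) := by

  obtain ⟨a, ha, rfl⟩ := hΩ.eq_Icc hsymm
  have hlen : volume.real (Set.Icc (-a) a) = 2 * a := by
    rw [Real.volume_real_Icc_of_le (by linarith)]; ring
  have hgen' : ∀ γ : Γ, |(γ : Eucl m × ℝ).2| ≠ a := by
    intro γ hγ
    refine hgen γ γ.2 ?_
    rw [frontier_Icc (by linarith)]
    rcases (abs_eq ha.le).1 hγ with h1 | h1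
    · exact Or.inr h1
    · exact Or.inl h1
  refine ⟨2 * a / latticeCovol Γ, hasDensity_modelSet hΓ ha, ?_⟩
  rw [isDualSystem_gaborSystem_iff hΓ ha hgen' (character_latticePoint A) hgB hhB]
  -- The sign of the argument is immaterial, because sinc is even.
  have hPhi : ∀ t, Phi (Set.Icc (-a) a) ε (-t) = Real.sinc (Real.pi * (t * (2 * a))) := fun t => by
    rw [Phi_eq_sinc _ (by rw [hlen]; linarith) hε0 hε1, hlen, ← Real.sinc_neg]
    congr 1
    ring
  simp only [hPhi, basisPoint_dualBasisOf, volume_fundamentalDomain_dualBasisOf]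
  constructor
  · intro H η v
    rw [H η η.2 v]
    simp only [ZeroMemClass.coe_eq_zero]
  · intro H η hη v
    rw [H ⟨η, hη⟩ v]
    simp only [Submodule.mk_eq_zero]
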